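/- **Setting.** Fix $K\ge 1$ (for $K=1$ the assumption below is void) and $\rho>1$. For each horizon $T\in\mathbb N_+$ let $P_1,\dots,P_K$ be probability distributions on $[0,1]$, possibly depending on $T$, with means $\mu_a$ and variances $\sigma_a^2$; arm $1$ is optimal, i.e. $\Delta_a:=\mu_1-\mu_a\ge 0$ for all $a\in[K]$. Put $$\overline\sigma_a=\frac{\sigma_a}{\sqrt{\rho\log T}},\qquad \overline\Delta_a=\frac{\Delta_a}{\rho\log T},\qquad \varphi(n;\sigma)=\frac{\sigma\vee n^{-1/2}}{\sqrt n}\quad(n>0,\ \sigma\ge 0).$$ **Algorithm (UCB-V).** For each $T\ge K$, a bandit run of length $T$ is given: in round $t$ an arm $A_t$ is pulled and a reward $X_t$ is received whose conditional distribution given $A_1,X_1,\dots,A_{t-1},X_{t-1},A_t$ is $P_{A_t}$. Each arm is pulled once in the first $K$ rounds, and for $K<t\le T$ $$A_t\in\arg\max_{a\in[K]}\ \bar X_{a,t}+\Big(\frac{\hat\sigma_{a,t}}{\sqrt{\rho\log T}}\vee\frac1{\sqrt{n_{a,t}}}\Big)\frac{\rho\log T}{\sqrt{n_{a,t}}}\qquad\text{(ties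 broken arbitrarily)},$$ where $n_{a,t}=\sum_{s=1}^{t-1}\mathbf 1\{A_s=a\}$, $\bar X_{a,t}=\frac1{n_{a,t}}\sum_{s=1}^{t-1}\mathbf 1\{A_s=a\}X_s$ and $\hat\sigma_{a,t}^2=\frac1{n_{a,t}}\sum_{s=1}^{t-1}\mathbf 1\{A_s=a\}(X_s-\bar X_{a,t})^2$. **Theorem 5.1.** Assume that for every $a\in\{2,\dots,K\}$ $$\limsup_{T\to\infty}\Big\{\max_{2\le b\le K}\Big(\frac1{K-1}-\frac{\overline\sigma_b^2}{T\overline\Delta_b^2}\Big)_+^{-1}\wedge\Big(\frac{\overline\sigma_a^2}{T\overline\Delta_a^2}-1\Big)_+^{-1}\wedge\frac{\overline\sigma_a}{\overline\sigma_1\vee T^{-1/2}}\Big\}<\infty,$$ where $x_+=\max\{x,0\}$ and the expressions take values in $[0,\infty]$, with $0^{-1}=\infty$, $\infty^{-1}=0$, $c/0=\infty$ for $c>0$, and $0/0=0$. Then for every $T\ge 2$ the equation $$\sum_{a\in[K]}\frac{\overline\sigma_a^2\vee(\varphi(n;\overline\sigma_1)+\overline\Delta_a)}{T(\varphi(n;\overline\sigma_1)+\overline\Delta_a)^2}=1$$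 has a unique solution $n=n_{1,T}^\star\in(0,\infty)$, and, with $$n_{a,T}^\star=\frac{\overline\sigma_a^2\vee(\varphi(n_{1,T}^\star;\overline\sigma_1)+\overline\Delta_a)}{(\varphi(n_{1,T}^\star;\overline\sigma_1)+\overline\Delta_a)^2}\qquad(2\le a\le K),$$ we have, for every $a\in[K]$, $$\frac{n_{a,T}}{n_{a,T}^\star}\xrightarrow{\ p\ }1\qquad(T\to\infty).$$ -/

import Mathlib

open MeasureTheory ProbabilityTheory Filter Topology
open scoped ENNReal

namespace UCBV

noncomputable section

/-- Mean of a reward distribution. -/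
def mean (P : Measure ℝ) : ℝ := ∫ x, x ∂P

/-- Standard deviation of a reward distribution. -/
def std (P : Measure ℝ) : ℝ := √(Var[id; P])

/-- Gap of arm `a` relative to arm `0`, the arm playing the role of the optimal arm. -/
def gap {K : ℕ} [NeZero K] (P : Fin K → Measure ℝ) (a : Fin K) : ℝ :=
  mean (P 0) - mean (P a)

/-- Normalized standard deviation `σ_a / √(ρ log T)`. -/
def sigmaBar {K : ℕ} (ρ : ℝ) (T : ℕ) (P : Fin K → Measure ℝ) (a : Fin K) : ℝ :=
  std (P a) / √(ρ * Real.log T)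

/-- Normalized gap `Δ_a / (ρ log T)`. -/
def gapBar {K : ℕ} [NeZero K] (ρ : ℝ) (T : ℕ) (P : Fin K → Measure ℝ) (a : Fin K) : ℝ :=
  gap P a / (ρ * Real.log T)

/-- `φ(n; σ) = (σ ∨ n^{-1/2}) / √n`. -/
def phi (n σ : ℝ) : ℝ := max σ (1 / √n) / √n

section Algorithm

variable {Ω : Type*} {K : ℕ}

/-- Number of pulls of arm `a` in rounds `1, …, t - 1`. -/
def pulls (A : ℕ → Ω → Fin K) (a : Fin K) (t : ℕ) (ω : Ω) : ℕ :=
  ((Finset.Ico 1 t).filter (fun s => A s ω = a)).card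

/-- Empirical mean of arm `a` based on rounds `1, …, t - 1`. -/
def empMean (A : ℕ → Ω → Fin K) (X : ℕ → Ω → ℝ) (a : Fin K) (t : ℕ) (ω : Ω) : ℝ :=
  (∑ s ∈ (Finset.Ico 1 t).filter (fun s => A s ω = a), X s ω) / pulls A a t ω

/-- Empirical variance of arm `a` based on rounds `1, …, t - 1`. -/
def empVar (A : ℕ → Ω → Fin K) (X : ℕ → Ω → ℝ) (a : Fin K) (t : ℕ) (ω : Ω) : ℝ :=
  (∑ s ∈ (Finset.Ico 1 t).filter (fun s => A s ω = a), (X s ω - empMean A X a t ω) ^ 2) /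
    pulls A a t ω

/-- Optimistic reward of arm `a` at round `t`, for horizon `T`. -/
def ucb (ρ : ℝ) (T : ℕ) (A : ℕ → Ω → Fin K) (X : ℕ → Ω → ℝ) (a : Fin K) (t : ℕ) (ω : Ω) : ℝ :=
  empMean A X a t ω +
    max (√(empVar A X a t ω) / √(ρ * Real.log T)) (1 / √(pulls A a t ω : ℝ)) *
      (ρ * Real.log T / √(pulls A a t ω : ℝ))

/-- The information available just before the reward of round `t` is revealed: the arms and
rewards of rounds `1, …, t - 1`, and the arm of round `t`. -/
@[reducible] def history (A : ℕ → Ω → Fin K) (X : ℕ → Ω → ℝ) (t : ℕ) : MeasurableSpace Ω :=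
  (⨆ s ∈ Finset.Ico 1 t,
    (MeasurableSpace.comap (A s) inferInstance ⊔ MeasurableSpace.comap (X s) inferInstance)) ⊔
  MeasurableSpace.comap (A t) inferInstance

/-- `A t` and `X t` (`1 ≤ t ≤ T`) are the arms pulled and the rewards received in a run of UCB-V
with exploration coefficient `ρ` and horizon `T` on the bandit with reward distributions `P`.
Ties in the maximization of the optimistic rewards, and the order of the first `K` pulls, are
resolved in an arbitrary (possibly randomized) way. -/
structure IsRun [MeasurableSpace Ω] (ρ : ℝ) (T : ℕ) (P : Fin K → Measure ℝ) (μ : Measure Ω)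
    (A : ℕ → Ω → Fin K) (X : ℕ → Ω → ℝ) : Prop where
  measurable_arm : ∀ t, Measurable (A t)
  measurable_reward : ∀ t, Measurable (X t)
  /-- Given the past and the current arm, the reward is drawn from that arm's distribution. -/
  reward_law : ∀ t ∈ Finset.Icc 1 T, ∀ B : Set ℝ, MeasurableSet B →
    μ⟦X t ⁻¹' B | history A X t⟧ =ᵐ[μ] fun ω => (P (A t ω)).real B
  /-- Each of the `K` arms is pulled (hence exactly once) in the first `K` rounds. -/
  initial : ∀ᵐ ω ∂μ, ∀ a, ∃ t ∈ Finset.Icc 1 K, A t ω = a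
  /-- In every later round an arm with the largest optimistic reward is pulled. -/
  greedy : ∀ᵐ ω ∂μ, ∀ t ∈ Finset.Icc (K + 1) T, ∀ b, ucb ρ T A X b t ω ≤ ucb ρ T A X (A t ω) t ω

end Algorithm

section Asymptotics

variable {K : ℕ} [NeZero K]

/-- The ratio `σ̄_a² / (T Δ̄_a²)` in `[0, ∞]` (with `c / 0 = ∞` for `c > 0`, and `0 / 0 = 0`). -/
def ratio (ρ : ℝ) (T : ℕ) (P : Fin K → Measure ℝ) (a : Fin K) : ℝ≥0∞ :=
  ENNReal.ofReal (sigmaBar ρ T P a ^ 2) / ENNReal.ofReal (T * gapBar ρ T P a ^ 2)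

/-- The quantity, with values in `[0, ∞]`, whose boundedness ensures stability. Subtraction in
`[0, ∞]` is truncated at `0`, so `(x - y)⁻¹` is `1 / (x - y)_+`, which is `∞` for `x ≤ y`. -/
def stabilityBound (ρ : ℝ) (T : ℕ) (P : Fin K → Measure ℝ) (a : Fin K) : ℝ≥0∞ :=
  (⨆ b : Fin K, ⨆ _ : b ≠ 0, (1 / ((K : ℝ≥0∞) - 1) - ratio ρ T P b)⁻¹) ⊓
    (ratio ρ T P a - 1)⁻¹ ⊓
    (ENNReal.ofReal (sigmaBar ρ T P a) / ENNReal.ofReal (max (sigmaBar ρ T P 0) (1 / √(T : ℝ))))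

/-- The explicit expression
`(σ̄_a² ∨ (φ(n; σ̄_1) + Δ̄_a)) / (φ(n; σ̄_1) + Δ̄_a)²`. -/
def armCount (ρ : ℝ) (T : ℕ) (P : Fin K → Measure ℝ) (n : ℝ) (a : Fin K) : ℝ :=
  max (sigmaBar ρ T P a ^ 2) (phi n (sigmaBar ρ T P 0) + gapBar ρ T P a) /
    (phi n (sigmaBar ρ T P 0) + gapBar ρ T P a) ^ 2

/-- `n` is a positive solution of the fixed-point equation. -/
def IsFixedPoint (ρ : ℝ) (T : ℕ) (P : Fin K → Measure ℝ) (n : ℝ) : Prop :=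
  0 < n ∧
    ∑ a : Fin K,
      max (sigmaBar ρ T P a ^ 2) (phi n (sigmaBar ρ T P 0) + gapBar ρ T P a) /
        (T * (phi n (sigmaBar ρ T P 0) + gapBar ρ T P a) ^ 2) = 1

/-- The deterministic pull count of arm `a`, given the pull count `n` of arm `0`. -/
def nStar (ρ : ℝ) (T : ℕ) (P : Fin K → Measure ℝ) (n : ℝ) (a : Fin K) : ℝ :=
  if a = 0 then n else armCount ρ T P n a

end Asymptotics

end

end UCBV

namespace UCBV

/-! ### The function `phi` and its inverse -/

/-! Write `R = ρ log T`. The argument has a probabilistic half and a deterministic half.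

With probability tending to one, all optimistic rewards at all rounds equal `μ_a + R φ(n_a; σ̄_a)`
up to a relative error `η` of the bonus (`IsRun.measure_not_concentrated_le`). This comes from a
time-uniform Bernstein inequality for the first two centred moments: Ville's inequality for
exponential supermartingales (`IsRun.ville`), with a union over a dyadic grid of exponents. At
deviation level `δ² R` each event has probability `T^(-δ²ρ)`, which beats the logarithmic size of
the grid.

On this event, greediness at the last pull of each arm forces all indices to agree approximately
(`gapBar_add_phi_le`): `φ(N_a; σ̄_a) ≈ φ(N_0; σ̄_0) + Δ̄_a`. Inverting `φ` gives `N_a ≈ count N_0 a`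
within a factor close to one (`pulls_near_count`). Summing over arms, `N_0` nearly solves `∑ count n
a = T`, the equation whose exact root is `n*`.

An approximate root is close to the exact one only if the equation is well conditioned. Since `n`
enters only through `φ`, this holds once some arm carries a fixed fraction of the pulls and `φ` is a
fixed fraction of its index `φ + Δ̄_a` (`sum_count_stable`). The stability assumption supplies such
an arm (`exists_wellConditioned_arm`). -/

lemma phi_eq {n : ℝ} (hn : 0 < n) (σ : ℝ) : phi n σ = max (σ / √n) (1 / n) := by
  have h : 0 < √n := Real.sqrt_pos.2 hn
  rw [phi, ← max_div_div_right h.le, div_div, Real.mul_self_sqrt hn.le]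

lemma inv_le_phi {n : ℝ} (hn : 0 < n) (σ : ℝ) : 1 / n ≤ phi n σ := by
  rw [phi_eq hn]; exact le_max_right _ _

lemma phi_pos {n : ℝ} (hn : 0 < n) (σ : ℝ) : 0 < phi n σ :=
  (one_div_pos.2 hn).trans_le (inv_le_phi hn σ)

lemma phi_antitone {n m σ : ℝ} (hn : 0 < n) (hnm : n ≤ m) (hσ : 0 ≤ σ) :
    phi m σ ≤ phi n σ := by
  rw [phi_eq hn, phi_eq (hn.trans_le hnm)]
  have h : 0 < √n := Real.sqrt_pos.2 hn
  gcongr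

/-- `φ` is a maximum of the powers `n^(-1/2)` and `n^(-1)`, so multiplying `n` by `c ≥ 1` divides it
by at most `c` and, in `phi_mul_le`, by at least `√c`. -/
lemma phi_div_le {n c : ℝ} (hn : 0 < n) (hc : 1 ≤ c) {σ : ℝ} (hσ : 0 ≤ σ) :
    phi n σ / c ≤ phi (c * n) σ := by
  have hc0 : 0 < c := by linarith
  rw [phi_eq hn, phi_eq (by positivity), ← max_div_div_right hc0.le, Real.sqrt_mul hc0.le]
  have h : 0 < √n := Real.sqrt_pos.2 hn
  have h' : √c ≤ c := by
    rw [Real.sqrt_le_left (by linarith)]; nlinarith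
  have h'' : 0 < √c := Real.sqrt_pos.2 hc0
  rw [div_div, div_div, mul_comm c n, mul_comm √n c]
  gcongr

lemma phi_mul_le {n c : ℝ} (hn : 0 < n) (hc : 1 ≤ c) (σ : ℝ) :
    phi (c * n) σ ≤ phi n σ / √c := by
  have hc0 : 0 < c := by linarith
  have h'' : 0 < √c := Real.sqrt_pos.2 hc0
  rw [phi_eq hn, phi_eq (by positivity), ← max_div_div_right h''.le, Real.sqrt_mul hc0.le]
  have h : 0 < √n := Real.sqrt_pos.2 hn
  have h' : √c ≤ c := by
    rw [Real.sqrt_le_left (by linarith)]; nlinarith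
  rw [div_div, div_div, mul_comm c n, mul_comm √n √c]
  gcongr

/-- The inverse of `phi · σ`. -/
noncomputable def phiInv (x σ : ℝ) : ℝ := max (σ ^ 2) x / x ^ 2

lemma phiInv_eq {x : ℝ} (hx : 0 < x) (σ : ℝ) : phiInv x σ = max ((σ / x) ^ 2) (1 / x) := by
  rw [phiInv, ← max_div_div_right (by positivity), div_pow]
  congr 1
  field_simp

lemma phiInv_pos {x : ℝ} (hx : 0 < x) (σ : ℝ) : 0 < phiInv x σ := by
  rw [phiInv_eq hx]; exact lt_max_of_lt_right (by positivity)

lemma phiInv_phi {n σ : ℝ} (hn : 0 < n) (hσ : 0 ≤ σ) : phiInv (phi n σ) σ = n := by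
  have h : 0 < √n := Real.sqrt_pos.2 hn
  have hs : √n * √n = n := Real.mul_self_sqrt hn.le
  rcases le_total (1 / √n) σ with h1 | h1
  · have hσ' : 0 < σ := lt_of_lt_of_le (by positivity) h1
    have e : phi n σ = σ / √n := by rw [phi, max_eq_left h1]
    rw [phiInv, e, max_eq_left]
    · field_simp; nlinarith
    · rw [div_le_iff₀ h] at h1 ⊢; nlinarith
  · have e : phi n σ = 1 / n := by rw [phi, max_eq_right h1, div_div, hs]
    rw [phiInv, e, max_eq_right]
    · field_simp
    · rw [le_div_iff₀ h] at h1; rw [le_div_iff₀ hn, ← hs]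
      have : 0 ≤ σ * √n := by positivity
      nlinarith

lemma phiInv_antitone {x y σ : ℝ} (hx : 0 < x) (hxy : x ≤ y) (hσ : 0 ≤ σ) :
    phiInv y σ ≤ phiInv x σ := by
  have hy : 0 < y := hx.trans_le hxy
  rw [phiInv_eq hx, phiInv_eq hy]
  have : 0 ≤ σ / y := by positivity
  gcongr

/-- The inverse mixes the powers `x^(-2)` and `x^(-1)`: scaling `x` by `c` costs a factor of at most
`c²` and, in `phiInv_mul_le`, at least `c`. -/
lemma phiInv_div_sq_le {x c : ℝ} (hx : 0 < x) (hc : 1 ≤ c) {σ : ℝ} :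
    phiInv x σ / c ^ 2 ≤ phiInv (c * x) σ := by
  have hc0 : 0 < c := by linarith
  rw [phiInv, phiInv, div_div, mul_pow, mul_comm (x ^ 2)]
  gcongr
  nlinarith

lemma phiInv_mul_le {x c : ℝ} (hx : 0 < x) (hc : 1 ≤ c) {σ : ℝ} :
    phiInv (c * x) σ ≤ phiInv x σ / c := by
  have hc0 : 0 < c := by linarith
  rw [phiInv, phiInv, div_div, div_le_div_iff₀ (by positivity) (by positivity)]
  have h : max (σ ^ 2) (c * x) ≤ c * max (σ ^ 2) x := by
    rw [mul_max_of_nonneg _ _ hc0.le]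
    exact max_le_max_right _ (by nlinarith [sq_nonneg σ])
  calc max (σ ^ 2) (c * x) * (x ^ 2 * c) ≤ (c * max (σ ^ 2) x) * (x ^ 2 * c) := by gcongr
    _ = _ := by ring

/-! ### The deterministic pull counts -/

/-- The deterministic pull count of arm `a` as a function of that of arm `0`. -/
noncomputable def count {K : ℕ} [NeZero K] (σ Δ : Fin K → ℝ) (n : ℝ) (a : Fin K) : ℝ :=
  phiInv (phi n (σ 0) + Δ a) (σ a)

section Count

variable {K : ℕ} [NeZero K] {σ Δ : Fin K → ℝ}

lemma count_zero (hσ : ∀ a, 0 ≤ σ a) (hΔ0 : Δ 0 = 0) {n : ℝ} (hn : 0 < n) :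
    count σ Δ n 0 = n := by
  rw [count, hΔ0, add_zero, phiInv_phi hn (hσ 0)]

lemma count_pos (hΔ : ∀ a, 0 ≤ Δ a) {n : ℝ} (hn : 0 < n) (a : Fin K) : 0 < count σ Δ n a :=
  phiInv_pos (add_pos_of_pos_of_nonneg (phi_pos hn _) (hΔ a)) _

lemma count_mono (hσ : ∀ a, 0 ≤ σ a) (hΔ : ∀ a, 0 ≤ Δ a) {n m : ℝ} (hn : 0 < n) (hnm : n ≤ m)
    (a : Fin K) : count σ Δ n a ≤ count σ Δ m a := by
  have := phi_pos (hn.trans_le hnm) (σ 0)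
  have := hΔ a
  exact phiInv_antitone (by linarith) (by linarith [phi_antitone hn hnm (hσ 0)]) (hσ a)

lemma count_mul_le (hσ : ∀ a, 0 ≤ σ a) (hΔ : ∀ a, 0 ≤ Δ a) {n c : ℝ} (hn : 0 < n) (hc : 1 ≤ c)
    (a : Fin K) : count σ Δ (c * n) a ≤ c ^ 2 * count σ Δ n a := by
  have hc0 : 0 < c := by linarith
  have h1 := phi_div_le hn hc (hσ 0)
  have h2 := phi_pos hn (σ 0)
  have h3 := phi_pos (mul_pos hc0 hn) (σ 0)
  have h4 := hΔ a
  rw [div_le_iff₀ hc0] at h1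
  have h5 : phi n (σ 0) + Δ a ≤ c * (phi (c * n) (σ 0) + Δ a) := by nlinarith
  have h6 := phiInv_antitone (by linarith) h5 (hσ a)
  have h7 := phiInv_div_sq_le (σ := σ a) (x := phi (c * n) (σ 0) + Δ a) (by linarith) hc
  rw [div_le_iff₀ (by positivity)] at h7
  unfold count
  nlinarith [sq_nonneg c]

/-- Arm `0` makes the monotonicity strict, since its count is `n` itself. -/
lemma sum_count_strictMono (hσ : ∀ a, 0 ≤ σ a) (hΔ : ∀ a, 0 ≤ Δ a) (hΔ0 : Δ 0 = 0) {n m : ℝ}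
    (hn : 0 < n) (hnm : n < m) : ∑ a, count σ Δ n a < ∑ a, count σ Δ m a := by
  refine Finset.sum_lt_sum (fun a _ => count_mono hσ hΔ hn hnm.le a) ⟨0, Finset.mem_univ _, ?_⟩
  rwa [count_zero hσ hΔ0 hn, count_zero hσ hΔ0 (hn.trans hnm)]

lemma continuousOn_sum_count (hΔ : ∀ a, 0 ≤ Δ a) :
    ContinuousOn (fun n => ∑ a, count σ Δ n a) (Set.Ioi 0) := by
  refine continuousOn_finsetSum _ fun a _ => ?_
  have h : ContinuousOn (fun n => phi n (σ 0) + Δ a) (Set.Ioi 0) := by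
    unfold phi
    have hs : ∀ x ∈ Set.Ioi (0 : ℝ), √x ≠ 0 := fun x hx => (Real.sqrt_pos.2 hx).ne'
    have hc : ContinuousOn (fun x : ℝ => √x) (Set.Ioi 0) := Real.continuous_sqrt.continuousOn
    exact ((ContinuousOn.sup continuousOn_const (continuousOn_const.div hc hs)).div hc hs).add
      continuousOn_const
  refine (ContinuousOn.sup continuousOn_const h).div (h.pow 2) fun x hx => ?_
  have := phi_pos hx (σ 0)
  have := hΔ a
  positivity

/-- Since `φ ≥ 1/n`, counts vanish linearly at `0`; this gives the lower endpoint for the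
intermediate value theorem. -/
lemma count_le (hσ : ∀ a, 0 ≤ σ a) (hΔ : ∀ a, 0 ≤ Δ a) {n : ℝ} (hn : 0 < n) (hn1 : n ≤ 1)
    (a : Fin K) : count σ Δ n a ≤ (σ a ^ 2 + 1) * n := by
  have h1 : 1 / n ≤ phi n (σ 0) + Δ a := by linarith [inv_le_phi hn (σ 0), hΔ a]
  refine (phiInv_antitone (by positivity) h1 (hσ a)).trans ?_
  rw [phiInv_eq (by positivity), div_div_eq_mul_div, one_div_one_div, div_one]
  refine max_le ?_ ?_
  · nlinarith [sq_nonneg (σ a), mul_nonneg (sq_nonneg (σ a)) hn.le,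
      mul_le_mul_of_nonneg_left hn1 (mul_nonneg (sq_nonneg (σ a)) hn.le)]
  · nlinarith [mul_nonneg (sq_nonneg (σ a)) hn.le]

lemma existsUnique_sum_count (hσ : ∀ a, 0 ≤ σ a) (hΔ : ∀ a, 0 ≤ Δ a) (hΔ0 : Δ 0 = 0) {s : ℝ}
    (hs : 0 < s) : ∃! n : ℝ, 0 < n ∧ ∑ a, count σ Δ n a = s := by
  have huniq : ∀ n m : ℝ, 0 < n → 0 < m → ∑ a, count σ Δ n a = s → ∑ a, count σ Δ m a = s →
      n = m := by
    intro n m hn hm h1 h2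
    rcases lt_trichotomy n m with h | h | h
    · linarith [sum_count_strictMono hσ hΔ hΔ0 hn h]
    · exact h
    · linarith [sum_count_strictMono hσ hΔ hΔ0 hm h]
  -- Arm `0` alone already contributes `s` at `n = s`.
  have hupper : s ≤ ∑ a, count σ Δ s a := by
    calc s = count σ Δ s 0 := (count_zero hσ hΔ0 hs).symm
      _ ≤ _ := Finset.single_le_sum (fun a _ => (count_pos hΔ hs a).le) (Finset.mem_univ _)
  have hlower : ∃ n, 0 < n ∧ n ≤ s ∧ ∑ a, count σ Δ n a ≤ s := by
    set M := ∑ a, (σ a ^ 2 + 1)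
    have hM : 0 < M := Finset.sum_pos (fun a _ => by positivity) ⟨0, Finset.mem_univ _⟩
    refine ⟨min (min 1 s) (s / M), by positivity, (min_le_left _ _).trans (min_le_right _ _), ?_⟩
    calc ∑ a, count σ Δ (min (min 1 s) (s / M)) a
        ≤ ∑ a, (σ a ^ 2 + 1) * min (min 1 s) (s / M) := Finset.sum_le_sum fun a _ =>
          count_le hσ hΔ (by positivity) ((min_le_left _ _).trans (min_le_left _ _)) a
      _ = M * min (min 1 s) (s / M) := by rw [Finset.sum_mul]
      _ ≤ M * (s / M) := by gcongr; exact min_le_right _ _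
      _ = s := by field_simp
  obtain ⟨l, hl, hls, hl'⟩ := hlower
  obtain ⟨n, hn, hn'⟩ := intermediate_value_Icc hls
    ((continuousOn_sum_count (σ := σ) hΔ).mono fun x hx => hl.trans_le hx.1) ⟨hl', hupper⟩
  exact ⟨n, ⟨hl.trans_le hn.1, hn'⟩, fun m hm => huniq _ _ hm.1 (hl.trans_le hn.1) hm.2 hn'⟩

end Count

/-! ### Conditioning of the fixed-point equation -/

section Stability

variable {K : ℕ} [NeZero K] {σ Δ : Fin K → ℝ}

/-- If some arm carries a fraction `c` of the pulls and `phi` is a fraction `c` of its index, then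
the total count determines `n` up to a factor `r`. -/
lemma sum_count_stable {c r : ℝ} (hc : 0 < c) (hc1 : c ≤ 1) (hr : 1 < r) :
    ∃ τ : ℝ, 1 < τ ∧ ∀ (σ Δ : Fin K → ℝ), (∀ a, 0 ≤ σ a) → (∀ a, 0 ≤ Δ a) →
      ∀ T n : ℝ, 0 < T → 0 < n → ∑ a, count σ Δ n a = T →
      (∃ a, c * T ≤ count σ Δ n a ∧ c * (phi n (σ 0) + Δ a) ≤ phi n (σ 0)) →
      ∀ m, 0 < m → T / τ < ∑ a, count σ Δ m a → ∑ a, count σ Δ m a < τ * T →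
      n / r < m ∧ m < r * n := by
  set s := √r
  have hs : 1 < s := by rw [Real.lt_sqrt] <;> linarith
  have hs0 : 0 < s := by linarith
  -- If `n` grows by `r`, `φ` drops by at least `s = √r`; as `φ` is at least a share `c` of the
  -- index of arm `a`, that index drops to at most a fraction `u`. If `n` shrinks by `r`, the index
  -- grows by at least `v`. The count of `a` then changes by `1/u` or `1/v`, and its share `c` of
  -- the total turns this into a change of the total by `1 + (1/u - 1)c` or `w`.
  set u := 1 - c * (1 - 1 / s) with hu
  have hs1 : 1 / s < 1 := by rw [div_lt_one hs0]; exact hs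
  have hs2 : 0 < 1 / s := by positivity
  have hu0 : 0 < u := by nlinarith
  have hu1 : u < 1 := by nlinarith
  set v := 1 + (s - 1) * c with hv
  have hv1 : 1 < v := by nlinarith
  have hv0 : 0 < v := by linarith
  have hui : 1 < 1 / u := by rw [lt_div_iff₀ hu0]; linarith
  have hvi : 1 / v < 1 := by rw [div_lt_one hv0]; exact hv1
  have hvi0 : 0 < 1 / v := by positivity
  set w := 1 - (1 - 1 / v) * c with hw
  have hw0 : 0 < w := by nlinarith
  have hw1 : w < 1 := by nlinarith
  have hwi : 1 < 1 / w := by rw [lt_div_iff₀ hw0]; linarith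
  refine ⟨min (1 + (1 / u - 1) * c) (1 / w), lt_min (by nlinarith) hwi, ?_⟩
  intro σ Δ hσ hΔ T n hT hn hsum ⟨a, ha1, ha2⟩ m hm hlow hup
  have hφ := phi_pos hn (σ 0)
  have hx : 0 < phi n (σ 0) + Δ a := by linarith [hΔ a]
  constructor
  · by_contra! hcon
    have hnr : 0 < n / r := by positivity
    have h1 := phi_mul_le hnr hr.le (σ 0)
    rw [mul_div_cancel₀ _ (by linarith : r ≠ 0), le_div_iff₀ hs0] at h1
    have h2 : v * (phi n (σ 0) + Δ a) ≤ phi (n / r) (σ 0) + Δ a := by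
      rw [hv]; nlinarith
    have h3 : count σ Δ (n / r) a ≤ count σ Δ n a / v :=
      (phiInv_antitone (by positivity) h2 (hσ a)).trans (phiInv_mul_le hx hv1.le)
    have h4 : ∑ b, count σ Δ m b ≤ ∑ b, count σ Δ n b - (1 - 1 / v) * count σ Δ n a := by
      rw [← Finset.add_sum_erase _ _ (Finset.mem_univ a),
        ← Finset.add_sum_erase _ (count σ Δ n) (Finset.mem_univ a)]
      have h5 : ∑ b ∈ Finset.univ.erase a, count σ Δ m b ≤
          ∑ b ∈ Finset.univ.erase a, count σ Δ n b :=
        Finset.sum_le_sum fun b _ => count_mono hσ hΔ hm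
          (hcon.trans (div_le_self hn.le hr.le)) b
      have h6 := count_mono hσ hΔ hm hcon a
      have h7 : count σ Δ n a / v = 1 / v * count σ Δ n a := by ring
      linarith
    have h8 : T * w ≤ T / min (1 + (1 / u - 1) * c) (1 / w) := by
      rw [le_div_iff₀ (lt_min (by nlinarith) (by linarith))]
      calc T * w * min (1 + (1 / u - 1) * c) (1 / w) ≤ T * w * (1 / w) := by
            gcongr; exact min_le_right _ _
        _ = T := by field_simp
    have h9 : (1 - 1 / v) * (c * T) ≤ (1 - 1 / v) * count σ Δ n a :=
      mul_le_mul_of_nonneg_left ha1 (by linarith)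
    rw [hsum] at h4
    have : T * w = T - (1 - 1 / v) * (c * T) := by rw [hw]; ring
    linarith
  · by_contra! hcon
    have hnr : 0 < r * n := by positivity
    have h1 := phi_mul_le hn hr.le (σ 0)
    have h2 : phi (r * n) (σ 0) + Δ a ≤ u * (phi n (σ 0) + Δ a) := by
      have : phi n (σ 0) / √r = 1 / s * phi n (σ 0) := by ring
      rw [hu]; nlinarith
    have h2' : 0 < phi (r * n) (σ 0) + Δ a := by linarith [phi_pos hnr (σ 0), hΔ a]
    have h3 : 1 / u * count σ Δ n a ≤ count σ Δ (r * n) a := by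
      refine le_trans ?_ (phiInv_antitone h2' h2 (hσ a))
      have := phiInv_mul_le (x := u * (phi n (σ 0) + Δ a)) (σ := σ a) (by positivity) hui.le
      rw [← mul_assoc, one_div_mul_cancel hu0.ne', one_mul, div_div_eq_mul_div, div_one] at this
      rw [one_div_mul_eq_div, div_le_iff₀ hu0]
      exact this
    have h4 : ∑ b, count σ Δ n b + (1 / u - 1) * count σ Δ n a ≤ ∑ b, count σ Δ m b := by
      rw [← Finset.add_sum_erase _ _ (Finset.mem_univ a),
        ← Finset.add_sum_erase _ (count σ Δ m) (Finset.mem_univ a)]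
      have h5 : ∑ b ∈ Finset.univ.erase a, count σ Δ n b ≤
          ∑ b ∈ Finset.univ.erase a, count σ Δ m b :=
        Finset.sum_le_sum fun b _ => count_mono hσ hΔ hn
          ((le_mul_of_one_le_left hn.le hr.le).trans hcon) b
      have h6 := count_mono hσ hΔ hnr hcon a
      linarith
    have h8 : min (1 + (1 / u - 1) * c) (1 / w) * T ≤ (1 + (1 / u - 1) * c) * T := by
      gcongr; exact min_le_left _ _
    have h9 : (1 / u - 1) * (c * T) ≤ (1 / u - 1) * count σ Δ n a :=
      mul_le_mul_of_nonneg_left ha1 (by linarith)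
    rw [hsum] at h4
    linarith

/-- The three regimes in which the fixed-point equation is well conditioned. -/
lemma exists_wellConditioned_arm (hσ : ∀ a, 0 ≤ σ a) (hΔ : ∀ a, 0 ≤ Δ a) (hΔ0 : Δ 0 = 0)
    {C T n : ℝ} (hC : 1 ≤ C) (hT : 0 < T) (hn : 0 < n) (hsum : ∑ a, count σ Δ n a = T)
    (h : ∀ a, a ≠ 0 →
      (∀ b, b ≠ 0 → σ b ^ 2 ≤ (1 / ((K : ℝ) - 1) - 1 / C) * (T * Δ b ^ 2)) ∨
      (1 + 1 / C) * (T * Δ a ^ 2) ≤ σ a ^ 2 ∨ σ a ≤ C * max (σ 0) (1 / √T)) :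
    ∃ a, 1 / (4 * C * K) * T ≤ count σ Δ n a ∧
      1 / (4 * C * K) * (phi n (σ 0) + Δ a) ≤ phi n (σ 0) := by
  have hK : (1 : ℝ) ≤ K := by exact_mod_cast NeZero.one_le
  have hK0 : (0 : ℝ) < K := by linarith
  have hC0 : 0 < C := by linarith
  have hCK : 1 ≤ C * K := by nlinarith
  have hφ := phi_pos hn (σ 0)
  have hx : ∀ a, 0 < phi n (σ 0) + Δ a := fun a => by linarith [hΔ a]
  have hc1 : 1 / (4 * C * K) ≤ 1 := by rw [div_le_one (by positivity)]; linarith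
  -- arm `0` is a witness as soon as it carries enough pulls
  have hzero : T ≤ 4 * C * K * n → ∃ a, 1 / (4 * C * K) * T ≤ count σ Δ n a ∧
      1 / (4 * C * K) * (phi n (σ 0) + Δ a) ≤ phi n (σ 0) := by
    intro h0
    refine ⟨0, ?_, ?_⟩
    · rw [count_zero hσ hΔ0 hn, one_div_mul_eq_div, div_le_iff₀ (by positivity)]
      linarith
    · rw [hΔ0, add_zero]; nlinarith
  have hinv : ∀ a, 1 / (phi n (σ 0) + Δ a) ≤ n := by
    intro a
    have h1 := inv_le_phi hn (σ 0)
    rw [div_le_iff₀ (hx a)]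
    rw [div_le_iff₀ hn] at h1
    nlinarith [hΔ a]
  have hnT : n ≤ T := by
    calc n = count σ Δ n 0 := (count_zero hσ hΔ0 hn).symm
      _ ≤ _ := Finset.single_le_sum (fun a _ => (count_pos hΔ hn a).le) (Finset.mem_univ 0)
      _ = T := hsum
  obtain ⟨a, ha⟩ : ∃ a, T / K ≤ count σ Δ n a := by
    by_contra! hcon
    have := Finset.sum_lt_sum_of_nonempty (s := Finset.univ) ⟨(0 : Fin K), Finset.mem_univ _⟩
      fun a _ => hcon a
    rw [hsum, Finset.sum_const, Finset.card_univ, Fintype.card_fin, nsmul_eq_mul,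
      mul_div_cancel₀ _ hK0.ne'] at this
    exact lt_irrefl _ this
  have haT : count σ Δ n a ≤ T := by
    rw [← hsum]
    exact Finset.single_le_sum (fun a _ => (count_pos hΔ hn a).le) (Finset.mem_univ a)
  have hca : 1 / (4 * C * K) * T ≤ count σ Δ n a := by
    refine le_trans ?_ ha
    rw [one_div_mul_eq_div]
    gcongr
    nlinarith
  have hcount : count σ Δ n a =
      max ((σ a / (phi n (σ 0) + Δ a)) ^ 2) (1 / (phi n (σ 0) + Δ a)) := phiInv_eq (hx a) _
  by_cases ha0 : a = 0
  · subst ha0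
    exact ⟨0, hca, by rw [hΔ0, add_zero]; nlinarith⟩
  rcases h a ha0 with h1 | h1 | h1
  · -- every suboptimal arm has a small share
    have hK2 : (2 : ℝ) ≤ K := by
      have : 2 ≤ K := by
        rcases a with ⟨i, hi⟩
        have : i ≠ 0 := fun h => ha0 (Fin.ext h)
        omega
      exact_mod_cast this
    -- The term `n` absorbs the branch `1/(φ + Δ b) ≤ 1/φ ≤ n` of the maximum. Summed over the `K -
    -- 1` suboptimal arms, the bounds leave room for a fixed fraction of `T`, which forces `n`
    -- itself to be of order `T`.
    have hb : ∀ b ∈ Finset.univ.erase (0 : Fin K),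
        count σ Δ n b ≤ max 0 (1 / ((K : ℝ) - 1) - 1 / C) * T + n := by
      intro b hb
      have hb0 : b ≠ 0 := (Finset.mem_erase.1 hb).1
      have hp : 0 ≤ max 0 (1 / ((K : ℝ) - 1) - 1 / C) * T := by positivity
      rw [count, phiInv_eq (hx b)]
      refine max_le ?_ (by linarith [hinv b])
      rw [div_pow, div_le_iff₀ (by have := hx b; positivity)]
      have h2 : Δ b ^ 2 ≤ (phi n (σ 0) + Δ b) ^ 2 :=
        pow_le_pow_left₀ (hΔ b) (by linarith) 2
      have h3 : σ b ^ 2 ≤ max 0 (1 / ((K : ℝ) - 1) - 1 / C) * T * Δ b ^ 2 := by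
        refine (h1 b hb0).trans ?_
        rw [mul_assoc]
        gcongr
        exact le_max_right _ _
      have h4 := mul_le_mul_of_nonneg_left h2 hp
      nlinarith [mul_nonneg hn.le (sq_nonneg (phi n (σ 0) + Δ b))]
    have hs := Finset.sum_le_sum hb
    rw [Finset.sum_const, Finset.card_erase_of_mem (Finset.mem_univ _), Finset.card_univ,
      Fintype.card_fin, nsmul_eq_mul, Nat.cast_sub NeZero.one_le, Nat.cast_one] at hs
    rw [← Finset.add_sum_erase _ _ (Finset.mem_univ (0 : Fin K)), count_zero hσ hΔ0 hn] at hsum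
    apply hzero
    have hk : 0 < (K : ℝ) - 1 := by linarith
    rcases le_total (1 / ((K : ℝ) - 1) - 1 / C) 0 with h5 | h5
    · rw [max_eq_left h5] at hs
      have : T ≤ K * n := by linarith
      nlinarith [mul_pos hK0 hn]
    · rw [max_eq_right h5] at hs
      have e : ((K : ℝ) - 1) * ((1 / ((K : ℝ) - 1) - 1 / C) * T + n) =
          T - (K - 1) * T / C + (K - 1) * n := by field_simp
      rw [e] at hs
      have h6 : (K - 1) * T / C ≤ K * n := by linarith
      rw [div_le_iff₀ hC0] at h6
      nlinarith [mul_pos (mul_pos hC0 hK0) hn]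
  -- No count exceeds `T`, so `σ a ≤ √T (φ + Δ a)`; against `σ a ≥ √(1 + 1/C) √T Δ a` this keeps `Δ
  -- a` a definite fraction below the whole index. The constant `1/(4C)` works because `(1 + y)(1 -
  -- y/4)² ≥ 1` on `[0, 1]`.
  · refine ⟨a, hca, ?_⟩
    have h2 : σ a ^ 2 ≤ T * (phi n (σ 0) + Δ a) ^ 2 := by
      have := (le_max_left _ _).trans (hcount.symm.trans_le haT)
      rwa [div_pow, div_le_iff₀ (by have := hx a; positivity)] at this
    have h3 : (1 + 1 / C) * Δ a ^ 2 ≤ (phi n (σ 0) + Δ a) ^ 2 := by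
      have := h1.trans h2
      rw [mul_left_comm] at this
      exact le_of_mul_le_mul_left this hT
    by_contra! hcon
    set x := phi n (σ 0) + Δ a
    have hx0 := hx a
    have hd : x * (1 - 1 / (4 * C)) < Δ a := by
      have : 1 / (4 * C * K) ≤ 1 / (4 * C) := by
        apply one_div_le_one_div_of_le (by positivity); nlinarith
      have := mul_le_mul_of_nonneg_right this hx0.le
      have hxd : x = phi n (σ 0) + Δ a := rfl
      linarith
    set y := 1 / C with hy
    have hy0 : 0 < y := by positivity
    have hy1 : y ≤ 1 := by rw [hy, div_le_one hC0]; exact hC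
    have hy4 : 1 / (4 * C) = y / 4 := by rw [hy]; field_simp
    rw [hy4] at hd
    have hd2 : (x * (1 - y / 4)) ^ 2 < Δ a ^ 2 := pow_lt_pow_left₀ hd
      (mul_nonneg hx0.le (by linarith)) two_ne_zero
    have h5 : (1 + y) * (x * (1 - y / 4)) ^ 2 < x ^ 2 :=
      lt_of_lt_of_le (mul_lt_mul_of_pos_left hd2 (by linarith)) h3
    have h6 : x ^ 2 ≤ (1 + y) * (x * (1 - y / 4)) ^ 2 := by
      have : 1 ≤ (1 + y) * (1 - y / 4) ^ 2 := by nlinarith [mul_nonneg hy0.le (sub_nonneg.2 hy1)]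
      calc x ^ 2 ≤ x ^ 2 * ((1 + y) * (1 - y / 4) ^ 2) :=
            le_mul_of_one_le_right (sq_nonneg x) this
        _ = _ := by ring
    linarith
  -- From `n ≤ T`, `√T φ(n) ≥ √T φ(T) = max (σ 0) (1/√T)`, so `σ a ≤ C √T φ(n)`. If the variance
  -- term gives the count `≥ T/K`, the index is at most `C K φ(n)`; if the term `1/(φ + Δ a) ≤ n`
  -- does, arm `0` has enough pulls.
  · rw [hcount] at ha
    rcases le_max_iff.1 ha with h2 | h2
    · refine ⟨a, hca, ?_⟩
      have hsT : 0 < √T := Real.sqrt_pos.2 hT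
      have h3 : max (σ 0) (1 / √T) ≤ √T * phi n (σ 0) := by
        have h4 : phi T (σ 0) ≤ phi n (σ 0) := phi_antitone hn hnT (hσ 0)
        rw [phi, div_le_iff₀ hsT] at h4
        linarith
      rw [div_pow, div_le_div_iff₀ hK0 (by have := hx a; positivity)] at h2
      set x := phi n (σ 0) + Δ a
      have hx0 := hx a
      have h5 : σ a ^ 2 ≤ (C * (√T * phi n (σ 0))) ^ 2 :=
        pow_le_pow_left₀ (hσ a) (h1.trans (by gcongr)) 2
      rw [mul_pow, mul_pow, Real.sq_sqrt hT.le] at h5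
      have h6 : x ^ 2 ≤ C ^ 2 * phi n (σ 0) ^ 2 * K := by
        refine le_of_mul_le_mul_left ?_ hT
        calc T * x ^ 2 ≤ σ a ^ 2 * K := h2
          _ ≤ C ^ 2 * (T * phi n (σ 0) ^ 2) * K := by gcongr
          _ = _ := by ring
      have h8 : x ^ 2 ≤ (C * K * phi n (σ 0)) ^ 2 := by
        calc x ^ 2 ≤ C ^ 2 * phi n (σ 0) ^ 2 * K := h6
          _ ≤ C ^ 2 * phi n (σ 0) ^ 2 * (K * K) := by gcongr; nlinarith
          _ = _ := by ring
      have h9 : x ≤ C * K * phi n (σ 0) := (sq_le_sq₀ hx0.le (by positivity)).1 h8 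
      rw [one_div_mul_eq_div, div_le_iff₀ (by positivity)]
      have : 0 < C * K * phi n (σ 0) := by positivity
      linarith
    · apply hzero
      have h3 := h2.trans (hinv a)
      rw [div_le_iff₀ hK0] at h3
      nlinarith [mul_pos hK0 hn]

end Stability

/-! ### Supermartingales of the rewards of one arm -/

section Reward

variable {Ω : Type*} {K : ℕ} {A : ℕ → Ω → Fin K} {X : ℕ → Ω → ℝ}

lemma measurable_arm_history (A : ℕ → Ω → Fin K) (X : ℕ → Ω → ℝ) (t : ℕ) :
    Measurable[history A X t] (A t) :=
  (comap_measurable (A t)).mono le_sup_right le_rfl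

lemma comap_le_history {s t : ℕ} (h1 : 1 ≤ s) (hst : s < t) :
    MeasurableSpace.comap (A s) inferInstance ⊔ MeasurableSpace.comap (X s) inferInstance ≤
      history A X t :=
  (le_iSup₂_of_le (f := fun s (_ : s ∈ Finset.Ico 1 t) => MeasurableSpace.comap (A s) inferInstance ⊔
    MeasurableSpace.comap (X s) inferInstance) s (Finset.mem_Ico.2 ⟨h1, hst⟩) le_rfl).trans
    le_sup_left

lemma measurable_reward_history {s t : ℕ} (h1 : 1 ≤ s) (hst : s < t) :
    Measurable[history A X t] (X s) :=
  (comap_measurable (X s)).mono (le_sup_right.trans (comap_le_history h1 hst)) le_rfl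

lemma history_mono {s t : ℕ} (h1 : 1 ≤ s) (hst : s ≤ t) : history A X s ≤ history A X t := by
  rcases hst.eq_or_lt with rfl | hlt
  · exact le_rfl
  refine sup_le (iSup₂_le fun r hr => ?_) (le_sup_left.trans (comap_le_history h1 hlt))
  rw [Finset.mem_Ico] at hr
  exact comap_le_history hr.1 (hr.2.trans_le hst)

/-- The process `∏_{s < t, A_s = a} g (X_s)`, indexed by `k = t - 1` and stopped when it
exceeds `c`. -/
noncomputable def stoppedProd (A : ℕ → Ω → Fin K) (X : ℕ → Ω → ℝ) (a : Fin K) (g : ℝ → ℝ≥0∞)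
    (c : ℝ≥0∞) : ℕ → Ω → ℝ≥0∞
  | 0 => fun _ => 1
  | k + 1 => fun ω =>
    if A (k + 1) ω = a then
      if c ≤ stoppedProd A X a g c k ω then stoppedProd A X a g c k ω
      else stoppedProd A X a g c k ω * g (X (k + 1) ω)
    else stoppedProd A X a g c k ω

lemma measurable_stoppedProd (A : ℕ → Ω → Fin K) (X : ℕ → Ω → ℝ) (a : Fin K) {g : ℝ → ℝ≥0∞}
    (hg : Measurable g) (c : ℝ≥0∞) (k : ℕ) :
    Measurable[history A X (k + 1)] (stoppedProd A X a g c k) := by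
  induction k with
  | zero => exact measurable_const
  | succ k ih =>
    have ih' := ih.mono (history_mono (Nat.le_add_left 1 k) (Nat.le_succ (k + 1))) le_rfl
    have hA : MeasurableSet[history A X (k + 2)] {ω | A (k + 1) ω = a} :=
      history_mono (Nat.le_add_left 1 k) (Nat.le_succ (k + 1)) _
        (measurable_arm_history A X (k + 1) (measurableSet_singleton a))
    have hX : Measurable[history A X (k + 2)] (X (k + 1)) :=
      measurable_reward_history (Nat.le_add_left 1 k) (Nat.lt_succ_self _)
    exact Measurable.ite hA (Measurable.ite (measurableSet_le measurable_const ih') ih'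
      (ih'.mul (hg.comp hX))) ih'

/-- Freezing the product at the first crossing of `c` keeps the crossing visible at the final time,
so Markov's inequality there controls all times at once. -/
lemma le_stoppedProd_of_le (A : ℕ → Ω → Fin K) (X : ℕ → Ω → ℝ) (a : Fin K) (g : ℝ → ℝ≥0∞)
    (c : ℝ≥0∞) (ω : Ω) {j k : ℕ} (hjk : j ≤ k)
    (hj : c ≤ ∏ s ∈ (Finset.Ico 1 (j + 1)).filter (fun s => A s ω = a), g (X s ω)) :
    c ≤ stoppedProd A X a g c k ω := by
  have hstep : ∀ k, c ≤ stoppedProd A X a g c k ω → c ≤ stoppedProd A X a g c (k + 1) ω := by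
    intro k hk
    by_cases hA : A (k + 1) ω = a <;> simp [stoppedProd, hA, hk]
  have hprod : ∀ k, c ≤ stoppedProd A X a g c k ω ∨ stoppedProd A X a g c k ω =
      ∏ s ∈ (Finset.Ico 1 (k + 1)).filter (fun s => A s ω = a), g (X s ω) := by
    intro k
    induction k with
    | zero => right; simp [stoppedProd]
    | succ k ih =>
      by_cases hk : c ≤ stoppedProd A X a g c k ω
      · exact Or.inl (hstep k hk)
      right
      rw [Finset.prod_filter, Finset.prod_Ico_succ_top (by omega), ← Finset.prod_filter,
        ← ih.resolve_left hk]
      by_cases hA : A (k + 1) ω = a <;> simp [stoppedProd, hA, hk]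
  induction k, hjk using Nat.le_induction with
  | base => exact (hprod j).elim id fun e => e ▸ hj
  | succ k _ ih => exact hstep k ih

variable [m0 : MeasurableSpace Ω] {ρ : ℝ} {T : ℕ} {P : Fin K → Measure ℝ} {μ : Measure Ω}

lemma IsRun.history_le (h : IsRun ρ T P μ A X) (t : ℕ) : history A X t ≤ m0 :=
  sup_le (iSup₂_le fun s _ => sup_le (h.measurable_arm s).comap_le (h.measurable_reward s).comap_le)
    (h.measurable_arm t).comap_le

variable [IsProbabilityMeasure μ] [∀ a, IsProbabilityMeasure (P a)]

/-- On a past event on which arm `a` is pulled, the reward has law `P a`. -/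
lemma IsRun.map_restrict (h : IsRun ρ T P μ A X) {t : ℕ} (ht : t ∈ Finset.Icc 1 T) {a : Fin K}
    {H : Set Ω} (hH : MeasurableSet[history A X t] H) (hHa : ∀ ω ∈ H, A t ω = a) :
    (μ.restrict H).map (X t) = μ H • P a := by
  ext B hB
  have hm := h.history_le t
  have hXB : MeasurableSet (X t ⁻¹' B) := h.measurable_reward t hB
  have e1 : ∫ ω in H, (μ⟦X t ⁻¹' B | history A X t⟧) ω ∂μ = μ.real (X t ⁻¹' B ∩ H) := by
    rw [setIntegral_condExp hm ((integrable_const (1 : ℝ)).indicator hXB) hH,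
      integral_indicator_const _ hXB, smul_eq_mul, mul_one, measureReal_restrict_apply hXB]
  have e2 : ∫ ω in H, (μ⟦X t ⁻¹' B | history A X t⟧) ω ∂μ = μ.real H * (P a).real B := by
    rw [setIntegral_congr_ae (g := fun _ => (P a).real B) (hm _ hH)
      ((h.reward_law t ht B hB).mono fun ω hω hωH => hω.trans (by simp only [hHa ω hωH])), setIntegral_const,
      smul_eq_mul]
  rw [Measure.map_apply (h.measurable_reward t) hB, Measure.restrict_apply hXB,
    Measure.smul_apply, smul_eq_mul, ← ENNReal.toReal_eq_toReal_iff' (measure_ne_top _ _)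
    (ENNReal.mul_ne_top (measure_ne_top _ _) (measure_ne_top _ _)), ENNReal.toReal_mul]
  exact e1.symm.trans e2

/-- The fresh reward factors out of any functional of the past. `IsRun.map_restrict` gives this for
indicators of past events, and linearity and monotone limits extend it. -/
lemma IsRun.lintegral_mul_reward (h : IsRun ρ T P μ A X) {t : ℕ} (ht : t ∈ Finset.Icc 1 T)
    (a : Fin K) {Z : Ω → ℝ≥0∞} (hZ : Measurable[history A X t] Z) {g : ℝ → ℝ≥0∞}
    (hg : Measurable g) :
    ∫⁻ ω in {ω | A t ω = a}, Z ω * g (X t ω) ∂μ =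
      (∫⁻ ω in {ω | A t ω = a}, Z ω ∂μ) * ∫⁻ x, g x ∂P a := by
  have hm := h.history_le t
  have hS : MeasurableSet[history A X t] {ω | A t ω = a} :=
    measurable_arm_history A X t (measurableSet_singleton a)
  have hgX : Measurable fun ω => g (X t ω) := hg.comp (h.measurable_reward t)
  refine Measurable.ennreal_induction
    (motive := fun Z => ∫⁻ ω in {ω | A t ω = a}, Z ω * g (X t ω) ∂μ =
      (∫⁻ ω in {ω | A t ω = a}, Z ω ∂μ) * ∫⁻ x, g x ∂P a) ?_ ?_ ?_ hZ
  · intro c H hH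
    have hH' := hm _ hH
    have hmap := h.map_restrict ht (hH.inter hS) (a := a) fun ω hω => hω.2
    have e : ∀ ω, H.indicator (fun _ => c) ω * g (X t ω) =
        H.indicator (fun ω => c * g (X t ω)) ω := fun ω => by
      by_cases hω : ω ∈ H <;> simp [hω]
    simp_rw [e]
    rw [lintegral_indicator hH', lintegral_indicator hH', lintegral_const_mul _ hgX,
      Measure.restrict_restrict hH', ← lintegral_map hg (h.measurable_reward t), hmap,
      lintegral_smul_measure, lintegral_const, Measure.restrict_apply_univ, smul_eq_mul, mul_assoc]
  · intro f₁ f₂ _ hf₁ _ h1 h2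
    have hfg : Measurable fun ω => f₁ ω * g (X t ω) := (hf₁.mono hm le_rfl).mul hgX
    simp only [Pi.add_apply, add_mul]
    rw [lintegral_add_left hfg, lintegral_add_left (hf₁.mono hm le_rfl),
      h1, h2, add_mul]
  · intro f hf hmono hind
    have hf' := fun n => (hf n).mono hm le_rfl
    have hfg : ∀ n, Measurable fun ω => f n ω * g (X t ω) := fun n => (hf' n).mul hgX
    simp only [ENNReal.iSup_mul]
    rw [lintegral_iSup hfg
      (fun i j hij ω => mul_le_mul_left (hmono hij ω) _), lintegral_iSup hf' hmono,
      ENNReal.iSup_mul]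
    exact iSup_congr hind

lemma IsRun.ae_reward_mem (h : IsRun ρ T P μ A X) {B : Set ℝ}
    (hP : ∀ a, ∀ᵐ x ∂P a, x ∈ B) : ∀ᵐ ω ∂μ, ∀ t ∈ Finset.Icc 1 T, X t ω ∈ B := by
  refine (ae_ball_iff (Finset.countable_toSet (Finset.Icc 1 T))).2 ?_
  intro t ht
  have key : ∀ a, ∀ᵐ ω ∂μ, A t ω = a → X t ω ∈ B := by
    intro a
    have hS : MeasurableSet[history A X t] {ω | A t ω = a} :=
      measurable_arm_history A X t (measurableSet_singleton a)
    have hmap := h.map_restrict ht hS (a := a) fun ω hω => hω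
    refine (ae_restrict_iff' (h.history_le t _ hS)).1 ?_
    refine ae_of_ae_map (h.measurable_reward t).aemeasurable (p := fun x => x ∈ B) ?_
    rw [hmap]
    exact Measure.ae_smul_measure (hP a) _
  filter_upwards [ae_all_iff.2 key] with ω hω using hω _ rfl

/-- Supermartingale property: a step changes the process only where arm `a` is pulled before
stopping, and there it multiplies by a fresh factor of mean at most one. -/
lemma IsRun.lintegral_stoppedProd_le (h : IsRun ρ T P μ A X) (a : Fin K) {g : ℝ → ℝ≥0∞}
    (hg : Measurable g) (hg1 : ∫⁻ x, g x ∂P a ≤ 1) (c : ℝ≥0∞) {k : ℕ} (hk : k ≤ T) :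
    ∫⁻ ω, stoppedProd A X a g c k ω ∂μ ≤ 1 := by
  induction k with
  | zero => simp [stoppedProd]
  | succ k ih =>
    refine le_trans ?_ (ih (by omega))
    set N := stoppedProd A X a g c k
    have hm := h.history_le (k + 1)
    have hN := measurable_stoppedProd A X a hg c k
    have hS : MeasurableSet[history A X (k + 1)] {ω | A (k + 1) ω = a} :=
      measurable_arm_history A X (k + 1) (measurableSet_singleton a)
    have hU : MeasurableSet[history A X (k + 1)] {ω | c ≤ N ω} :=
      measurableSet_le measurable_const hN
    rw [← lintegral_add_compl _ (hm _ hS), ← lintegral_add_compl N (hm _ hS)]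
    refine add_le_add ?_ (le_of_eq ?_)
    · have h1 : Measurable[history A X (k + 1)] ({ω | c ≤ N ω}.indicator N) := hN.indicator hU
      have h2 : Measurable[history A X (k + 1)] ({ω | c ≤ N ω}ᶜ.indicator N) :=
        hN.indicator hU.compl
      calc ∫⁻ ω in {ω | A (k + 1) ω = a}, stoppedProd A X a g c (k + 1) ω ∂μ
          = ∫⁻ ω in {ω | A (k + 1) ω = a}, ({ω | c ≤ N ω}.indicator N ω +
              {ω | c ≤ N ω}ᶜ.indicator N ω * g (X (k + 1) ω)) ∂μ := by
            refine setLIntegral_congr_fun (hm _ hS) fun ω hω => ?_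
            have hω : A (k + 1) ω = a := hω
            by_cases hc : c ≤ N ω
            · simp [stoppedProd, hω, hc, N]
            · simp [stoppedProd, hω, hc, N]
        _ = ∫⁻ ω in {ω | A (k + 1) ω = a}, {ω | c ≤ N ω}.indicator N ω ∂μ +
              (∫⁻ ω in {ω | A (k + 1) ω = a}, {ω | c ≤ N ω}ᶜ.indicator N ω ∂μ) *
                ∫⁻ x, g x ∂P a := by
            rw [lintegral_add_left (h1.mono hm le_rfl),
              h.lintegral_mul_reward (Finset.mem_Icc.2 ⟨by omega, hk⟩) a h2 hg]
        _ ≤ ∫⁻ ω in {ω | A (k + 1) ω = a}, {ω | c ≤ N ω}.indicator N ω ∂μ +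
              ∫⁻ ω in {ω | A (k + 1) ω = a}, {ω | c ≤ N ω}ᶜ.indicator N ω ∂μ := by
            gcongr; exact mul_le_of_le_one_right' hg1
        _ = ∫⁻ ω in {ω | A (k + 1) ω = a}, N ω ∂μ := by
            rw [← lintegral_add_left (h1.mono hm le_rfl)]
            congr 1 with ω
            exact congrFun (Set.indicator_self_add_compl {ω | c ≤ N ω} N) ω
    · refine setLIntegral_congr_fun (hm _ hS).compl fun ω hω => ?_
      have hω : ¬ A (k + 1) ω = a := hω
      simp [stoppedProd, hω, N]

/-- Ville's inequality for the multiplicative functionals of the rewards of one arm. -/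
lemma IsRun.ville (h : IsRun ρ T P μ A X) (a : Fin K) {g : ℝ → ℝ≥0∞}
    (hg : Measurable g) (hg1 : ∫⁻ x, g x ∂P a ≤ 1) {c : ℝ≥0∞} (hc0 : c ≠ 0) (hc : c ≠ ⊤) :
    μ {ω | ∃ t ∈ Finset.Icc 1 T,
      c ≤ ∏ s ∈ (Finset.Ico 1 t).filter (fun s => A s ω = a), g (X s ω)} ≤ c⁻¹ := by
  have hN := (measurable_stoppedProd A X a hg c T).mono (h.history_le (T + 1)) le_rfl
  calc _ ≤ μ {ω | c ≤ stoppedProd A X a g c T ω} := by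
        refine measure_mono fun ω ⟨t, ht, hω⟩ => ?_
        rw [Finset.mem_Icc] at ht
        obtain ⟨j, rfl⟩ : ∃ j, t = j + 1 := ⟨t - 1, by omega⟩
        exact le_stoppedProd_of_le A X a g c ω (by omega : j ≤ T) hω
    _ ≤ (∫⁻ ω, stoppedProd A X a g c T ω ∂μ) / c :=
        meas_ge_le_lintegral_div hN.aemeasurable hc0 hc
    _ ≤ 1 / c := by gcongr; exact h.lintegral_stoppedProd_le a hg hg1 c le_rfl
    _ = c⁻¹ := one_div c

end Reward

/-! ### Concentration of the rewards of one arm -/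

/-- Integrate `exp y ≤ 1 + y + y²`, valid for `|y| ≤ 1`; the linear term vanishes and `1 + z ≤ exp
z` absorbs the quadratic one. -/
lemma lintegral_exp_le_one {P : Measure ℝ} [IsProbabilityMeasure P] {f : ℝ → ℝ}
    (hf : Measurable f) (hf1 : ∀ᵐ x ∂P, |f x| ≤ 1) (hf0 : ∫ x, f x ∂P = 0) {w : ℝ}
    (hw : ∫ x, f x ^ 2 ∂P ≤ w) {l : ℝ} (hl0 : 0 ≤ l) (hl1 : l ≤ 1) :
    ∫⁻ x, ENNReal.ofReal (Real.exp (l * f x - l ^ 2 * w)) ∂P ≤ 1 := by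
  have hfi : Integrable f P := Integrable.of_bound hf.aestronglyMeasurable 1 hf1
  have hf2 : Integrable (fun x => f x ^ 2) P := by
    refine Integrable.of_bound (hf.pow_const 2).aestronglyMeasurable 1 ?_
    filter_upwards [hf1] with x hx
    rw [Real.norm_eq_abs, abs_pow]
    exact pow_le_one₀ (abs_nonneg _) hx
  have hlf : ∀ᵐ x ∂P, |l * f x| ≤ 1 := by
    filter_upwards [hf1] with x hx
    rw [abs_mul, abs_of_nonneg hl0]
    exact mul_le_one₀ hl1 (abs_nonneg _) hx
  have hexp : ∀ᵐ x ∂P, Real.exp (l * f x - l ^ 2 * w) ≤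
      Real.exp (-(l ^ 2 * w)) * (1 + l * f x + l ^ 2 * f x ^ 2) := by
    filter_upwards [hlf] with x hx
    rw [sub_eq_neg_add, Real.exp_add]
    gcongr
    have := (abs_le.1 (Real.abs_exp_sub_one_sub_id_le hx)).2
    rw [mul_pow] at this
    linarith
  have hint : Integrable (fun x => 1 + l * f x + l ^ 2 * f x ^ 2) P :=
    ((integrable_const 1).add (hfi.const_mul l)).add (hf2.const_mul _)
  have hval : ∫ x, (1 + l * f x + l ^ 2 * f x ^ 2) ∂P = 1 + l ^ 2 * ∫ x, f x ^ 2 ∂P := by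
    have hlin : Integrable (fun x => 1 + l * f x) P := (integrable_const 1).add (hfi.const_mul l)
    rw [integral_add hlin (hf2.const_mul _),
      integral_add (integrable_const 1) (hfi.const_mul l), integral_const_mul, integral_const_mul,
      hf0]
    simp
  calc ∫⁻ x, ENNReal.ofReal (Real.exp (l * f x - l ^ 2 * w)) ∂P
      ≤ ∫⁻ x, ENNReal.ofReal
          (Real.exp (-(l ^ 2 * w)) * (1 + l * f x + l ^ 2 * f x ^ 2)) ∂P :=
        lintegral_mono_ae (hexp.mono fun x hx => ENNReal.ofReal_le_ofReal hx)
    _ = ENNReal.ofReal (∫ x, Real.exp (-(l ^ 2 * w)) * (1 + l * f x + l ^ 2 * f x ^ 2) ∂P) :=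
        (ofReal_integral_eq_lintegral_ofReal (hint.const_mul _)
          (hexp.mono fun x hx => (Real.exp_pos _).le.trans hx)).symm
    _ ≤ 1 := by
        rw [ENNReal.ofReal_le_one, integral_const_mul, hval]
        calc Real.exp (-(l ^ 2 * w)) * (1 + l ^ 2 * ∫ x, f x ^ 2 ∂P)
            ≤ Real.exp (-(l ^ 2 * w)) * Real.exp (l ^ 2 * w) := by
              gcongr
              have := mul_le_mul_of_nonneg_left hw (sq_nonneg l)
              linarith [Real.add_one_le_exp (l ^ 2 * w)]
          _ = 1 := by rw [← Real.exp_add]; simp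

/-- Optimizing the exponential bound over the dyadic grid of parameters. -/
lemma le_of_forall_dyadic {L v S : ℝ} {T : ℕ} (hL : 1 ≤ L) (hv : 0 ≤ v) (hvT : v ≤ T)
    (h : ∀ j ≤ Nat.log 2 T, 1 / 2 ^ j * S - (1 / 2 ^ j) ^ 2 * v < L) :
    S ≤ 3 * √(L * v) + 2 * L := by
  have hS : ∀ j ≤ Nat.log 2 T, S ≤ L * 2 ^ j + v / 2 ^ j := by
    intro j hj
    have := h j hj
    have hp : (0 : ℝ) < 2 ^ j := by positivity
    have e : (1 / 2 ^ j * S - (1 / 2 ^ j) ^ 2 * v) * 2 ^ j = S - v / 2 ^ j := by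
      field_simp
    have := mul_lt_mul_of_pos_right this hp
    linarith
  have hs0 : 0 ≤ √(L * v) := Real.sqrt_nonneg _
  rcases le_total v L with h1 | h1
  · have := hS 0 (Nat.zero_le _)
    norm_num at this
    linarith
  have hL0 : 0 < L := by linarith
  have hv0 : 0 < v := by linarith
  set q := √(v / L) with hq
  have hq2 : q * q = v / L := Real.mul_self_sqrt (by positivity)
  have hvL : 1 ≤ v / L := by rw [le_div_iff₀ hL0]; linarith
  have hq1 : 1 ≤ q := Real.one_le_sqrt.2 hvL
  obtain ⟨j, hj1, hj2⟩ := exists_nat_pow_near hq1 one_lt_two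
  have hjT : j ≤ Nat.log 2 T := by
    refine Nat.le_log_of_pow_le (by norm_num) ?_
    have : (2 : ℝ) ^ j ≤ T := by
      calc (2 : ℝ) ^ j ≤ q := hj1
        _ ≤ q * q := le_mul_of_one_le_left (by linarith) hq1
        _ = v / L := hq2
        _ ≤ v := div_le_self hv hL
        _ ≤ T := hvT
    exact_mod_cast this
  have hLq : L * q = √(L * v) := by
    rw [eq_comm, Real.sqrt_eq_iff_mul_self_eq (by positivity) (by positivity)]
    have : L * q * (L * q) = L * L * (q * q) := by ring
    rw [this, hq2]; field_simp
  have hvq : v = L * q * q := by rw [mul_assoc, hq2]; field_simp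
  have h3 : v / 2 ^ j ≤ 2 * (L * q) := by
    rw [div_le_iff₀ (by positivity)]
    rw [pow_succ] at hj2
    have : 0 ≤ L * q := by positivity
    nlinarith
  have h4 : L * 2 ^ j ≤ L * q := by gcongr
  have := hS j hjT
  linarith

section Bernstein

variable {Ω : Type*} {K : ℕ} {A : ℕ → Ω → Fin K} {X : ℕ → Ω → ℝ}

/-- Sum of `f` over the rewards of arm `a` in rounds `1, …, t - 1`. -/
noncomputable def armSum (A : ℕ → Ω → Fin K) (X : ℕ → Ω → ℝ) (f : ℝ → ℝ) (a : Fin K) (t : ℕ)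
    (ω : Ω) : ℝ :=
  ∑ s ∈ (Finset.Ico 1 t).filter (fun s => A s ω = a), f (X s ω)

lemma pulls_le (A : ℕ → Ω → Fin K) (a : Fin K) (t : ℕ) (ω : Ω) : pulls A a t ω ≤ t :=
  (Finset.card_filter_le _ _).trans (by simp)

lemma armSum_neg (A : ℕ → Ω → Fin K) (X : ℕ → Ω → ℝ) (f : ℝ → ℝ) (a : Fin K) (t : ℕ) (ω : Ω) :
    armSum A X (fun x => -f x) a t ω = -armSum A X f a t ω := by
  simp [armSum]

variable [MeasurableSpace Ω] {ρ : ℝ} {T : ℕ} {P : Fin K → Measure ℝ} {μ : Measure Ω}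
  [IsProbabilityMeasure μ] [∀ a, IsProbabilityMeasure (P a)]

/-- Ville's inequality at level `exp L` for each exponent `2^(-j)`, followed by a union bound. The
grid makes the best exponent available for the random pull count, uniformly in time. -/
lemma IsRun.bernstein (h : IsRun ρ T P μ A X) (a : Fin K) {f : ℝ → ℝ} (hf : Measurable f)
    (hf1 : ∀ᵐ x ∂P a, |f x| ≤ 1) (hf0 : ∫ x, f x ∂P a = 0) {w : ℝ} (hw : ∫ x, f x ^ 2 ∂P a ≤ w)
    (hw0 : 0 ≤ w) (hw1 : w ≤ 1) {L : ℝ} (hL : 1 ≤ L) :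
    μ {ω | ∃ t ∈ Finset.Icc 1 T,
      3 * √(L * (w * pulls A a t ω)) + 2 * L < armSum A X f a t ω} ≤
      (Nat.log 2 T + 1 : ℕ) * ENNReal.ofReal (Real.exp (-L)) := by
  set g : ℕ → ℝ → ℝ≥0∞ := fun j x =>
    ENNReal.ofReal (Real.exp (1 / 2 ^ j * f x - (1 / 2 ^ j) ^ 2 * w))
  have hg : ∀ j, Measurable (g j) := fun j =>
    ((hf.const_mul _).sub_const _).exp.ennreal_ofReal
  have hprod : ∀ j t ω, ∏ s ∈ (Finset.Ico 1 t).filter (fun s => A s ω = a), g j (X s ω) =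
      ENNReal.ofReal (Real.exp
        (1 / 2 ^ j * armSum A X f a t ω - (1 / 2 ^ j) ^ 2 * (w * pulls A a t ω))) := by
    intro j t ω
    rw [← ENNReal.ofReal_prod_of_nonneg fun _ _ => (Real.exp_pos _).le, ← Real.exp_sum,
      Finset.sum_sub_distrib, ← Finset.mul_sum, Finset.sum_const, nsmul_eq_mul, armSum, pulls]
    ring_nf
  calc _ ≤ μ (⋃ j ∈ Finset.range (Nat.log 2 T + 1), {ω | ∃ t ∈ Finset.Icc 1 T,
        ENNReal.ofReal (Real.exp L) ≤
          ∏ s ∈ (Finset.Ico 1 t).filter (fun s => A s ω = a), g j (X s ω)}) := by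
        refine measure_mono fun ω ⟨t, ht, hω⟩ => ?_
        by_contra hcon
        simp only [Set.mem_iUnion, not_exists, Set.mem_ofPred_eq, not_and, Finset.mem_range,
          Nat.lt_succ_iff, not_le, hprod] at hcon
        refine hω.not_ge (le_of_forall_dyadic (T := T) hL (by positivity) ?_ fun j hj => ?_)
        · have h1 : (pulls A a t ω : ℝ) ≤ T := by
            exact_mod_cast (pulls_le A a t ω).trans (Finset.mem_Icc.1 ht).2
          nlinarith
        · have := hcon j hj t ht
          rw [ENNReal.ofReal_lt_ofReal_iff (Real.exp_pos _), Real.exp_lt_exp] at this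
          exact this
    _ ≤ ∑ j ∈ Finset.range (Nat.log 2 T + 1), (ENNReal.ofReal (Real.exp L))⁻¹ := by
        refine (measure_biUnion_finset_le _ _).trans (Finset.sum_le_sum fun j _ => ?_)
        refine h.ville a (hg j) (lintegral_exp_le_one hf hf1 hf0 hw (by positivity) ?_) ?_ ?_
        · rw [div_le_one (by positivity)]; exact one_le_pow₀ one_le_two
        · exact (ENNReal.ofReal_pos.2 (Real.exp_pos L)).ne'
        · exact ENNReal.ofReal_ne_top
    _ = _ := by
        rw [Finset.sum_const, Finset.card_range, nsmul_eq_mul, Real.exp_neg,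
          ENNReal.ofReal_inv_of_pos (Real.exp_pos L)]

/-- Two-sided form of `IsRun.bernstein`. -/
lemma IsRun.bernstein_abs (h : IsRun ρ T P μ A X) (a : Fin K) {f : ℝ → ℝ} (hf : Measurable f)
    (hf1 : ∀ᵐ x ∂P a, |f x| ≤ 1) (hf0 : ∫ x, f x ∂P a = 0) {w : ℝ} (hw : ∫ x, f x ^ 2 ∂P a ≤ w)
    (hw0 : 0 ≤ w) (hw1 : w ≤ 1) {L : ℝ} (hL : 1 ≤ L) :
    μ {ω | ∃ t ∈ Finset.Icc 1 T,
      3 * √(L * (w * pulls A a t ω)) + 2 * L < |armSum A X f a t ω|} ≤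
      2 * ((Nat.log 2 T + 1 : ℕ) * ENNReal.ofReal (Real.exp (-L))) := by
  have h1 := h.bernstein a hf hf1 hf0 hw hw0 hw1 hL
  have h2 := h.bernstein a (f := fun x => -f x) hf.neg (by simpa using hf1) (by simp [integral_neg, hf0])
    (by simpa using hw) hw0 hw1 hL
  refine le_trans (measure_mono ?_) ((measure_union_le _ _).trans ((add_le_add h1 h2).trans_eq (two_mul _).symm))
  rintro ω ⟨t, ht, hω⟩
  rcases lt_abs.1 hω with h | h
  · exact Or.inl ⟨t, ht, h⟩
  · exact Or.inr ⟨t, ht, by rw [← armSum_neg] at h; exact h⟩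

end Bernstein

/-! ### Concentration of the optimistic rewards -/

/-- After multiplication by `n` the bonus is a single square root, so a relative error in `max (n V)
R` passes directly to the bonus. -/
lemma bonus_eq {R n V : ℝ} (hR : 0 < R) (hn : 0 < n) :
    n * (max (√V / √R) (1 / √n) * (R / √n)) = √(R * max (n * V) R) := by
  have hsn : 0 < √n := Real.sqrt_pos.2 hn
  have hsR : 0 < √R := Real.sqrt_pos.2 hR
  have en : √n * √n = n := Real.mul_self_sqrt hn.le
  have eR : √R * √R = R := Real.mul_self_sqrt hR.le
  rw [mul_max_of_nonneg _ _ hR.le, Real.sqrt_monotone.map_max, Real.sqrt_mul_self hR.le,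
    Real.sqrt_mul hR.le, Real.sqrt_mul hn.le, max_mul_of_nonneg _ _ (by positivity),
    mul_max_of_nonneg _ _ hn.le]
  congr 1
  · calc n * (√V / √R * (R / √n)) = (√n * √n) * (√V / √R * ((√R * √R) / √n)) := by rw [en, eR]
      _ = _ := by field_simp
  · calc n * (1 / √n * (R / √n)) = n * R / (√n * √n) := by field_simp
      _ = R := by rw [en]; field_simp

lemma mul_phi_eq {R n V : ℝ} (hR : 0 < R) (hn : 0 < n) :
    n * (R * phi n (√V / √R)) = √(R * max (n * V) R) := by
  rw [← bonus_eq hR hn, phi]; ring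

lemma abs_sqrt_mul_sub_le {R p q d : ℝ} (hR : 0 ≤ R) (hp : 0 ≤ p) (hq : 0 < q)
    (h : |p - q| ≤ d * q) : |√(R * p) - √(R * q)| ≤ d * √(R * q) := by
  have hsq : 0 < √q := Real.sqrt_pos.2 hq
  have hsp : 0 ≤ √p := Real.sqrt_nonneg p
  rw [Real.sqrt_mul hR, Real.sqrt_mul hR, ← mul_sub, abs_mul, abs_of_nonneg (Real.sqrt_nonneg R),
    mul_left_comm]
  gcongr
  have e : p - q = (√p - √q) * (√p + √q) := by
    have := Real.mul_self_sqrt hp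
    have := Real.mul_self_sqrt hq.le
    linarith
  rw [e, abs_mul, abs_of_pos (by linarith : 0 < √p + √q)] at h
  have h2 : |√p - √q| * √q ≤ |√p - √q| * (√p + √q) :=
    mul_le_mul_of_nonneg_left (by linarith) (abs_nonneg _)
  have h3 : |√p - √q| * √q ≤ d * √q * √q := by
    rw [mul_assoc, Real.mul_self_sqrt hq.le]; linarith
  exact le_of_mul_le_mul_right h3 hsq

section Concentrated

variable {Ω : Type*} {K : ℕ} {A : ℕ → Ω → Fin K} {X : ℕ → Ω → ℝ}

/-- All the optimistic rewards are within a factor `η` of the exploration bonus from their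
idealized values. -/
def Concentrated (η ρ : ℝ) (T : ℕ) (P : Fin K → Measure ℝ) (A : ℕ → Ω → Fin K)
    (X : ℕ → Ω → ℝ) (ω : Ω) : Prop :=
  ∀ a, ∀ t ∈ Finset.Icc 1 T, pulls A a t ω ≠ 0 →
    |ucb ρ T A X a t ω - mean (P a) - ρ * Real.log T * phi (pulls A a t ω) (sigmaBar ρ T P a)| ≤
      η * (ρ * Real.log T * phi (pulls A a t ω) (sigmaBar ρ T P a))

lemma mul_empMean_sub {a : Fin K} {t : ℕ} {ω : Ω} (hn : pulls A a t ω ≠ 0) (m : ℝ) :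
    pulls A a t ω * (empMean A X a t ω - m) = armSum A X (fun x => x - m) a t ω := by
  have hn' : (pulls A a t ω : ℝ) ≠ 0 := Nat.cast_ne_zero.2 hn
  rw [armSum, Finset.sum_sub_distrib, Finset.sum_const, nsmul_eq_mul, empMean, mul_sub,
    mul_div_cancel₀ _ hn', pulls]

/-- Recentring at `m` leaves the error `S₁ (M - m)`, no larger than `|S₁|` because both means lie in
`[0, 1]`. -/
lemma mul_empVar {a : Fin K} {t : ℕ} {ω : Ω} (hn : pulls A a t ω ≠ 0) (m V : ℝ) :
    pulls A a t ω * empVar A X a t ω = pulls A a t ω * V +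
      armSum A X (fun x => (x - m) ^ 2 - V) a t ω -
      armSum A X (fun x => x - m) a t ω * (empMean A X a t ω - m) := by
  have hn' : (pulls A a t ω : ℝ) ≠ 0 := Nat.cast_ne_zero.2 hn
  have h1 := mul_empMean_sub (X := X) hn m
  rw [empVar, mul_div_cancel₀ _ hn']
  set M := empMean A X a t ω
  have h2 : ∀ s, (X s ω - M) ^ 2 = (X s ω - m) ^ 2 - V + V - 2 * (M - m) * (X s ω - m) +
      (M - m) ^ 2 := fun s => by ring
  simp_rw [h2]
  rw [Finset.sum_add_distrib, Finset.sum_sub_distrib, Finset.sum_add_distrib, ← Finset.mul_sum,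
    Finset.sum_const, Finset.sum_const, nsmul_eq_mul, nsmul_eq_mul]
  have e1 : ∑ s ∈ (Finset.Ico 1 t).filter (fun s => A s ω = a), (X s ω - m) =
      armSum A X (fun x => x - m) a t ω := rfl
  have e2 : ∑ s ∈ (Finset.Ico 1 t).filter (fun s => A s ω = a), ((X s ω - m) ^ 2 - V) =
      armSum A X (fun x => (x - m) ^ 2 - V) a t ω := rfl
  have e3 : (((Finset.Ico 1 t).filter (fun s => A s ω = a)).card : ℝ) = pulls A a t ω := rfl
  rw [e1, e2, e3]
  linear_combination (M - m) * h1

lemma empMean_mem_Icc {a : Fin K} {t : ℕ} {ω : Ω} (hn : pulls A a t ω ≠ 0)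
    (hX : ∀ s ∈ Finset.Ico 1 t, X s ω ∈ Set.Icc (0 : ℝ) 1) :
    empMean A X a t ω ∈ Set.Icc (0 : ℝ) 1 := by
  have hn' : (0 : ℝ) < pulls A a t ω := by positivity
  have hX' : ∀ s ∈ (Finset.Ico 1 t).filter (fun s => A s ω = a), X s ω ∈ Set.Icc (0 : ℝ) 1 :=
    fun s hs => hX s (Finset.mem_filter.1 hs).1
  refine ⟨div_nonneg (Finset.sum_nonneg fun s hs => (hX' s hs).1) hn'.le, ?_⟩
  rw [empMean, div_le_one hn']
  refine (Finset.sum_le_card_nsmul _ _ 1 fun s hs => (hX' s hs).2).trans_eq ?_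
  rw [nsmul_eq_mul, mul_one, pulls]

/-- Deterministic consequence of the concentration of the first two moments. -/
lemma abs_ucb_sub_le {ρ : ℝ} {T : ℕ} {a : Fin K} {t : ℕ} {ω : Ω} {m V δ : ℝ}
    (hR : 0 < ρ * Real.log T) (hn : pulls A a t ω ≠ 0) (hm : m ∈ Set.Icc (0 : ℝ) 1)
    (hδ0 : 0 < δ) (hδ1 : δ ≤ 1)
    (hX : ∀ s ∈ Finset.Ico 1 t, X s ω ∈ Set.Icc (0 : ℝ) 1)
    (h1 : |armSum A X (fun x => x - m) a t ω| ≤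
      3 * √(δ ^ 2 * (ρ * Real.log T) * (V * pulls A a t ω)) + 2 * (δ ^ 2 * (ρ * Real.log T)))
    (h2 : |armSum A X (fun x => (x - m) ^ 2 - V) a t ω| ≤
      3 * √(δ ^ 2 * (ρ * Real.log T) * (V * pulls A a t ω)) + 2 * (δ ^ 2 * (ρ * Real.log T))) :
    |ucb ρ T A X a t ω - m -
      ρ * Real.log T * phi (pulls A a t ω) (√V / √(ρ * Real.log T))| ≤
      15 * δ * (ρ * Real.log T * phi (pulls A a t ω) (√V / √(ρ * Real.log T))) := by
  have hn' : (0 : ℝ) < pulls A a t ω := by positivity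
  have hmean := mul_empMean_sub (X := X) hn m
  have hvar := mul_empVar (X := X) hn m V
  have hM := empMean_mem_Icc hn hX
  have hbonus := bonus_eq (V := empVar A X a t ω) hR hn'
  have hphi := mul_phi_eq (V := V) hR hn'
  have hucb : ucb ρ T A X a t ω = empMean A X a t ω +
    max (√(empVar A X a t ω) / √(ρ * Real.log T)) (1 / √(pulls A a t ω : ℝ)) *
      (ρ * Real.log T / √(pulls A a t ω : ℝ)) := rfl
  set R := ρ * Real.log T
  set n : ℝ := (pulls A a t ω : ℝ)
  set M := empMean A X a t ω
  set V' := empVar A X a t ω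
  set S1 := armSum A X (fun x => x - m) a t ω
  set S2 := armSum A X (fun x => (x - m) ^ 2 - V) a t ω
  set q := max (n * V) R
  have hqR : R ≤ q := le_max_right _ _
  have hqV : n * V ≤ q := le_max_left _ _
  have hq : 0 < q := hR.trans_le hqR
  have hroot : √(δ ^ 2 * R * (V * n)) ≤ δ * √(R * q) := by
    rw [mul_assoc, Real.sqrt_mul (sq_nonneg δ), Real.sqrt_sq hδ0.le]
    gcongr
    linarith
  have hRq : R ≤ √(R * q) := by
    rw [Real.le_sqrt hR.le (by positivity), sq]; gcongr
  have hqq : √(R * q) ≤ q := by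
    rw [Real.sqrt_le_left hq.le, sq]; gcongr
  have hδR : δ ^ 2 * R ≤ δ * √(R * q) := by
    rw [sq, mul_assoc]
    gcongr
    exact (mul_le_of_le_one_left hR.le hδ1).trans hRq
  have h1' : |S1| ≤ 5 * δ * √(R * q) := by linarith
  have h2' : |S2| ≤ 5 * δ * √(R * q) := by linarith
  have hMm : |M - m| ≤ 1 := abs_le.2 ⟨by linarith [hM.1, hm.2], by linarith [hM.2, hm.1]⟩
  -- Each of `S1`, `S2` is at most `5δ√(R q)` and both enter the variance, hence `10`; the deviation
  -- of the mean adds the other `5` of the final `15`.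
  have hvar' : |max (n * V') R - q| ≤ 10 * δ * q := by
    calc |max (n * V') R - q| ≤ |n * V' - n * V| := abs_max_sub_max_le_abs _ _ _
      _ = |S2 - S1 * (M - m)| := by rw [hvar]; ring_nf
      _ ≤ |S2| + |S1| * |M - m| := by rw [← abs_mul]; exact abs_sub _ _
      _ ≤ |S2| + |S1| * 1 := by gcongr
      _ ≤ 10 * δ * √(R * q) := by linarith
      _ ≤ 10 * δ * q := by gcongr
  have h3 := abs_sqrt_mul_sub_le hR.le (le_max_of_le_right hR.le) hq hvar'
  refine le_of_mul_le_mul_left ?_ hn'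
  calc n * |ucb ρ T A X a t ω - m - R * phi n (√V / √R)|
      = |n * (ucb ρ T A X a t ω - m - R * phi n (√V / √R))| := by
        rw [abs_mul, abs_of_pos hn']
    _ = |S1 + (√(R * max (n * V') R) - √(R * q))| := by
        rw [hucb, ← hmean, ← hbonus, ← hphi]; ring_nf
    _ ≤ |S1| + |√(R * max (n * V') R) - √(R * q)| := abs_add_le _ _
    _ ≤ 15 * δ * √(R * q) := by linarith
    _ = n * (15 * δ * (R * phi n (√V / √R))) := by rw [← hphi]; ring

end Concentrated

/-! ### Moments of distributions on the unit interval -/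

section Moments

variable {P : Measure ℝ} [IsProbabilityMeasure P]

lemma integrable_of_continuous_of_mem_Icc (hP : ∀ᵐ x ∂P, x ∈ Set.Icc (0 : ℝ) 1) {f : ℝ → ℝ}
    (hf : Continuous f) : Integrable f P := by
  obtain ⟨C, hC⟩ := isCompact_Icc.exists_bound_of_continuousOn (s := Set.Icc (0 : ℝ) 1)
    hf.continuousOn
  exact Integrable.of_bound hf.aestronglyMeasurable C (hP.mono hC)

lemma mean_mem_Icc (hP : ∀ᵐ x ∂P, x ∈ Set.Icc (0 : ℝ) 1) : mean P ∈ Set.Icc (0 : ℝ) 1 := by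
  have hi := integrable_of_continuous_of_mem_Icc hP continuous_id
  refine ⟨integral_nonneg_of_ae (hP.mono fun x hx => hx.1), ?_⟩
  calc ∫ x, x ∂P ≤ ∫ _, (1 : ℝ) ∂P :=
        integral_mono_ae hi (integrable_const 1) (hP.mono fun x hx => hx.2)
    _ = 1 := by simp

lemma variance_eq_integral_sub_mean (P : Measure ℝ) : Var[id; P] = ∫ x, (x - mean P) ^ 2 ∂P := by
  rw [variance_eq_integral measurable_id.aemeasurable]
  rfl

lemma ae_sub_mean_sq_le_one (hP : ∀ᵐ x ∂P, x ∈ Set.Icc (0 : ℝ) 1) :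
    ∀ᵐ x ∂P, (x - mean P) ^ 2 ≤ 1 := by
  have hm := mean_mem_Icc hP
  filter_upwards [hP] with x hx
  rw [sq_le_one_iff_abs_le_one, abs_le]
  exact ⟨by linarith [hx.1, hm.2], by linarith [hx.2, hm.1]⟩

lemma variance_le_one (hP : ∀ᵐ x ∂P, x ∈ Set.Icc (0 : ℝ) 1) : Var[id; P] ≤ 1 := by
  rw [variance_eq_integral_sub_mean]
  calc ∫ x, (x - mean P) ^ 2 ∂P ≤ ∫ _, (1 : ℝ) ∂P :=
        integral_mono_ae (integrable_of_continuous_of_mem_Icc hP (by fun_prop))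
          (integrable_const 1) (ae_sub_mean_sq_le_one hP)
    _ = 1 := by simp

lemma integral_sub_mean (hP : ∀ᵐ x ∂P, x ∈ Set.Icc (0 : ℝ) 1) : ∫ x, (x - mean P) ∂P = 0 := by
  rw [integral_sub (f := fun x => x) (integrable_of_continuous_of_mem_Icc hP continuous_id)
    (integrable_const _)]
  simp [mean]

lemma integral_sq_sub_variance (hP : ∀ᵐ x ∂P, x ∈ Set.Icc (0 : ℝ) 1) :
    ∫ x, ((x - mean P) ^ 2 - Var[id; P]) ∂P = 0 := by
  rw [integral_sub (integrable_of_continuous_of_mem_Icc hP (by fun_prop)) (integrable_const _),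
    variance_eq_integral_sub_mean]
  simp

/-- Since `(x - m)⁴ ≤ (x - m)²`, the squared deviations have variance at most `Var`, so one
Bernstein bound with the same `w` serves both moments. -/
lemma integral_sq_sub_variance_sq_le (hP : ∀ᵐ x ∂P, x ∈ Set.Icc (0 : ℝ) 1) :
    ∫ x, ((x - mean P) ^ 2 - Var[id; P]) ^ 2 ∂P ≤ Var[id; P] := by
  have h0 := variance_nonneg id P
  have h1 := variance_le_one hP
  set v := Var[id; P] with hv
  calc ∫ x, ((x - mean P) ^ 2 - v) ^ 2 ∂P
      ≤ ∫ x, ((1 - 2 * v) * (x - mean P) ^ 2 + v ^ 2) ∂P := by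
        refine integral_mono_ae (integrable_of_continuous_of_mem_Icc hP (by fun_prop))
          (integrable_of_continuous_of_mem_Icc hP (by fun_prop)) ?_
        filter_upwards [ae_sub_mean_sq_le_one hP] with x hx
        nlinarith [sq_nonneg (x - mean P)]
    _ = v - v ^ 2 := by
        rw [integral_add (integrable_of_continuous_of_mem_Icc hP (by fun_prop))
          (integrable_const _), integral_const_mul, ← variance_eq_integral_sub_mean, ← hv]
        simp
        ring
    _ ≤ v := by nlinarith

end Moments

/-! ### Probability that concentration fails -/

section Probability

variable {Ω : Type*} {K : ℕ} {A : ℕ → Ω → Fin K} {X : ℕ → Ω → ℝ}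
variable [MeasurableSpace Ω] {ρ : ℝ} {T : ℕ} {P : Fin K → Measure ℝ} {μ : Measure Ω}
  [IsProbabilityMeasure μ] [∀ a, IsProbabilityMeasure (P a)]

lemma IsRun.measure_not_concentrated_le (h : IsRun ρ T P μ A X)
    (hP : ∀ a, ∀ᵐ x ∂P a, x ∈ Set.Icc (0 : ℝ) 1) {δ : ℝ} (hδ0 : 0 < δ) (hδ1 : δ ≤ 1)
    (hL : 1 ≤ δ ^ 2 * (ρ * Real.log T)) :
    μ {ω | ¬ Concentrated (15 * δ) ρ T P A X ω} ≤
      K * (4 * ((Nat.log 2 T + 1 : ℕ) *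
        ENNReal.ofReal (Real.exp (-(δ ^ 2 * (ρ * Real.log T)))))) := by
  set L := δ ^ 2 * (ρ * Real.log T) with hLdef
  have hR : 0 < ρ * Real.log T := by
    by_contra! hcon
    nlinarith [sq_nonneg δ]
  set p := (Nat.log 2 T + 1 : ℕ) * ENNReal.ofReal (Real.exp (-L))
  set E : (Fin K → ℝ → ℝ) → Fin K → Set Ω := fun f a => {ω | ∃ t ∈ Finset.Icc 1 T,
    3 * √(L * (Var[id; P a] * pulls A a t ω)) + 2 * L < |armSum A X (f a) a t ω|}
  have hbound : ∀ a, μ (E (fun a x => x - mean (P a)) a ∪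
      E (fun a x => (x - mean (P a)) ^ 2 - Var[id; P a]) a) ≤ 4 * p := by
    intro a
    have h0 := variance_nonneg id (P a)
    have h1 := variance_le_one (hP a)
    have hb1 : μ (E (fun a x => x - mean (P a)) a) ≤ 2 * p := by
      refine h.bernstein_abs a (by fun_prop) ?_ (integral_sub_mean (hP a))
        (variance_eq_integral_sub_mean (P a)).ge h0 h1 hL
      filter_upwards [ae_sub_mean_sq_le_one (hP a)] with x hx
      exact (sq_le_one_iff_abs_le_one _).1 hx
    have hb2 : μ (E (fun a x => (x - mean (P a)) ^ 2 - Var[id; P a]) a) ≤ 2 * p := by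
      refine h.bernstein_abs a (by fun_prop) ?_ (integral_sq_sub_variance (hP a))
        (integral_sq_sub_variance_sq_le (hP a)) h0 h1 hL
      filter_upwards [ae_sub_mean_sq_le_one (hP a)] with x hx
      exact abs_le.2 ⟨by nlinarith [sq_nonneg (x - mean (P a))], by linarith⟩
    calc _ ≤ 2 * p + 2 * p := (measure_union_le _ _).trans (add_le_add hb1 hb2)
      _ = 4 * p := by rw [← add_mul]; norm_num
  have hX := h.ae_reward_mem hP
  calc μ {ω | ¬ Concentrated (15 * δ) ρ T P A X ω}
      ≤ μ (⋃ a, (E (fun a x => x - mean (P a)) a ∪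
          E (fun a x => (x - mean (P a)) ^ 2 - Var[id; P a]) a)) := by
        refine measure_mono_ae ?_
        filter_upwards [hX] with ω hω hcon
        by_contra hE
        refine hcon fun a t ht hn => ?_
        rw [Finset.mem_Icc] at ht
        have hE' : ω ∉ E (fun a x => x - mean (P a)) a ∪
            E (fun a x => (x - mean (P a)) ^ 2 - Var[id; P a]) a :=
          fun hmem => hE (Set.mem_iUnion.2 ⟨a, hmem⟩)
        rw [Set.mem_union, not_or] at hE'
        have h1 := not_lt.1 fun hlt => hE'.1 ⟨t, Finset.mem_Icc.2 ht, hlt⟩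
        have h2 := not_lt.1 fun hlt => hE'.2 ⟨t, Finset.mem_Icc.2 ht, hlt⟩
        refine abs_ucb_sub_le hR hn (mean_mem_Icc (hP a)) hδ0 hδ1
          (fun s hs => ?_) h1 h2
        rw [Finset.mem_Ico] at hs
        exact hω s (Finset.mem_Icc.2 ⟨hs.1, by omega⟩)
    _ ≤ ∑ a, μ (E (fun a x => x - mean (P a)) a ∪
          E (fun a x => (x - mean (P a)) ^ 2 - Var[id; P a]) a) :=
        measure_iUnion_fintype_le _ _
    _ ≤ ∑ _ : Fin K, 4 * p := Finset.sum_le_sum fun a _ => hbound a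
    _ = K * (4 * p) := by rw [Finset.sum_const, Finset.card_univ, Fintype.card_fin, nsmul_eq_mul]

end Probability

lemma tendsto_concentration_bound (K : ℕ) {s : ℝ} (hs : 0 < s) :
    Tendsto (fun T : ℕ => (K : ℝ≥0∞) * (4 * ((Nat.log 2 T + 1 : ℕ) *
      ENNReal.ofReal (Real.exp (-(s * Real.log T)))))) atTop (𝓝 0) := by
  have hlin : Tendsto (fun x : ℝ => (x / Real.log 2 + 1) * Real.exp (-(s * x))) atTop (𝓝 0) := by
    have h1 := (Real.tendsto_pow_mul_exp_neg_atTop_nhds_zero 1).comp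
      (tendsto_id.const_mul_atTop hs)
    have h0 := (Real.tendsto_pow_mul_exp_neg_atTop_nhds_zero 0).comp
      (tendsto_id.const_mul_atTop hs)
    have := (h1.const_mul (1 / (s * Real.log 2))).add h0
    simp only [mul_zero, add_zero] at this
    refine this.congr fun x => ?_
    simp only [Function.comp, id, pow_one, pow_zero]
    field_simp
  have hreal : Tendsto (fun T : ℕ => K * (4 * ((Nat.log 2 T + 1 : ℕ) *
      Real.exp (-(s * Real.log T))))) atTop (𝓝 0) := by
    have hup : Tendsto (fun T : ℕ => K * (4 * ((Real.log T / Real.log 2 + 1) *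
        Real.exp (-(s * Real.log T))))) atTop (𝓝 0) := by
      have := ((hlin.comp (Real.tendsto_log_atTop.comp
        tendsto_natCast_atTop_atTop)).const_mul 4).const_mul (K : ℝ)
      simpa using this
    refine squeeze_zero (fun T => by positivity) (fun T => ?_) hup
    gcongr
    push_cast
    gcongr
    exact Real.natLog_le_logb T 2
  have := ENNReal.tendsto_ofReal hreal
  rw [ENNReal.ofReal_zero] at this
  refine this.congr fun T => ?_
  rw [ENNReal.ofReal_mul (by positivity), ENNReal.ofReal_mul (by positivity),
    ENNReal.ofReal_mul (by positivity), ENNReal.ofReal_natCast, ENNReal.ofReal_natCast]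
  norm_num

/-! ### Pull counts along a run -/

section Pulls

variable {Ω : Type*} {K : ℕ} {A : ℕ → Ω → Fin K} {X : ℕ → Ω → ℝ} {ω : Ω}

lemma pulls_succ (A : ℕ → Ω → Fin K) (a : Fin K) {t : ℕ} (ht : 1 ≤ t) (ω : Ω) :
    pulls A a (t + 1) ω = pulls A a t ω + if A t ω = a then 1 else 0 := by
  rw [pulls, pulls, Finset.card_filter, Finset.card_filter, Finset.sum_Ico_succ_top ht]

lemma pulls_mono (A : ℕ → Ω → Fin K) (a : Fin K) {s t : ℕ} (hst : s ≤ t) (ω : Ω) :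
    pulls A a s ω ≤ pulls A a t ω :=
  Finset.card_le_card (Finset.filter_subset_filter _ (Finset.Ico_subset_Ico_right hst))

lemma sum_pulls (A : ℕ → Ω → Fin K) (t : ℕ) (ω : Ω) : ∑ a, pulls A a t ω = t - 1 := by
  rw [← Nat.card_Ico 1 t]
  exact (Finset.card_eq_sum_card_fiberwise fun _ _ => Finset.mem_coe.2 (Finset.mem_univ _)).symm

lemma one_le_pulls (hinit : ∀ a, ∃ t ∈ Finset.Icc 1 K, A t ω = a) (a : Fin K) {t : ℕ}
    (ht : K + 1 ≤ t) : 1 ≤ pulls A a t ω := by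
  obtain ⟨s, hs, hsa⟩ := hinit a
  rw [Finset.mem_Icc] at hs
  exact Finset.card_pos.2 ⟨s, Finset.mem_filter.2 ⟨Finset.mem_Ico.2 ⟨hs.1, by omega⟩, hsa⟩⟩

lemma pulls_init (hinit : ∀ a, ∃ t ∈ Finset.Icc 1 K, A t ω = a) (a : Fin K) :
    pulls A a (K + 1) ω = 1 := by
  have h1 := fun a => one_le_pulls hinit a le_rfl
  by_contra hne
  have h2 : ∑ _ : Fin K, 1 < ∑ b, pulls A b (K + 1) ω :=
    Finset.sum_lt_sum (fun b _ => h1 b) ⟨a, Finset.mem_univ a, lt_of_le_of_ne (h1 a) (Ne.symm hne)⟩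
  rw [sum_pulls] at h2
  simp at h2

/-- A second pull must occur after the initial `K` rounds, where the choice is greedy. At that round
the arm has one pull fewer than at the end. -/
lemma exists_last_pull (hinit : ∀ a, ∃ t ∈ Finset.Icc 1 K, A t ω = a) (a : Fin K) {T : ℕ}
    (hT : K + 1 ≤ T) (h2 : 2 ≤ pulls A a T ω) :
    ∃ t, K + 1 ≤ t ∧ t < T ∧ A t ω = a ∧ pulls A a T ω = pulls A a t ω + 1 := by
  induction T, hT using Nat.le_induction with
  | base => rw [pulls_init hinit] at h2; omega
  | succ T hT ih =>
    have hs := pulls_succ A a (by omega : 1 ≤ T) ω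
    by_cases hA : A T ω = a
    · exact ⟨T, hT, Nat.lt_succ_self T, hA, by rw [hs, if_pos hA]⟩
    · rw [if_neg hA, add_zero] at hs
      obtain ⟨t, h3, h4, h5, h6⟩ := ih (by omega)
      exact ⟨t, h3, by omega, h5, by omega⟩

variable {ρ : ℝ} {T : ℕ} {P : Fin K → Measure ℝ}

lemma sigmaBar_nonneg (a : Fin K) : 0 ≤ sigmaBar ρ T P a := by
  unfold sigmaBar std; positivity

variable [NeZero K]

/-- Comparison of the indices of two arms at the last pull of the first one. -/
lemma gapBar_add_phi_le {η : ℝ} (hη1 : η ≤ 1) (hR : 0 < ρ * Real.log T)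
    (hT : K + 1 ≤ T) (hinit : ∀ a, ∃ t ∈ Finset.Icc 1 K, A t ω = a)
    (hgreedy : ∀ t ∈ Finset.Icc (K + 1) T, ∀ b, ucb ρ T A X b t ω ≤ ucb ρ T A X (A t ω) t ω)
    (hconc : Concentrated η ρ T P A X ω) (a b : Fin K) (ha : 2 ≤ pulls A a T ω) :
    gapBar ρ T P a + (1 - η) * phi (pulls A b T ω) (sigmaBar ρ T P b) ≤
      gapBar ρ T P b + (1 + η) * phi ((pulls A a T ω : ℝ) - 1) (sigmaBar ρ T P a) := by
  obtain ⟨t, ht1, ht2, hta, hpt⟩ := exists_last_pull hinit a hT ha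
  have hg := hgreedy t (Finset.mem_Icc.2 ⟨ht1, ht2.le⟩) b
  rw [hta] at hg
  have hpa := one_le_pulls hinit a ht1
  have hpb := one_le_pulls hinit b ht1
  have htT : t ∈ Finset.Icc 1 T := Finset.mem_Icc.2 ⟨by omega, ht2.le⟩
  have h1 := (abs_le.1 (hconc a t htT (by omega))).2
  have h2 := (abs_le.1 (hconc b t htT (by omega))).1
  have hpt' : (pulls A a T ω : ℝ) - 1 = pulls A a t ω := by rw [hpt]; push_cast; ring
  -- The count of `b` only grows after round `t`, so its final bonus bounds the one at `t` from
  -- below.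
  have hmono : phi (pulls A b T ω) (sigmaBar ρ T P b) ≤ phi (pulls A b t ω) (sigmaBar ρ T P b) :=
    phi_antitone (by exact_mod_cast hpb) (by exact_mod_cast pulls_mono A b ht2.le ω)
      (sigmaBar_nonneg b)
  rw [hpt']
  set R := ρ * Real.log T with hRdef
  have hgap : ∀ a, gapBar ρ T P a * R = mean (P 0) - mean (P a) := fun a => by
    rw [gapBar, gap, div_mul_cancel₀ _ hR.ne']
  have hga := hgap a
  have hgb := hgap b
  refine le_of_mul_le_mul_right ?_ hR
  have h3 := mul_le_mul_of_nonneg_left hmono (mul_nonneg (sub_nonneg.2 hη1) hR.le)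
  linarith

end Pulls

/-! ### From index comparisons to pull counts -/

lemma phi_le_inv_sqrt {n σ : ℝ} (hn : 1 ≤ n) (hσ : σ ≤ 1) : phi n σ ≤ 1 / √n := by
  have h : 0 < √n := Real.sqrt_pos.2 (by linarith)
  rw [phi_eq (by linarith)]
  refine max_le (by gcongr) ?_
  refine one_div_le_one_div_of_le h ?_
  rw [Real.sqrt_le_left (by linarith)]; nlinarith

section Comparison

variable {K : ℕ} [NeZero K] {σ Δ : Fin K → ℝ}

/-- If the indices of all arms nearly agree at their last pulls, the pull counts are nearly
determined by that of arm `0`. -/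
lemma pulls_near_count (hσ : ∀ a, 0 ≤ σ a) (hσ1 : ∀ a, σ a ≤ 1) (hΔ : ∀ a, 0 ≤ Δ a)
    (hΔ0 : Δ 0 = 0) {N : Fin K → ℕ} (hN : ∀ a, 1 ≤ N a) {T : ℕ} (hsum : ∑ a, N a = T - 1)
    {η D : ℝ} (hη0 : 0 < η) (hη1 : η ≤ 1 / 2) (hΔD : ∀ a, Δ a ≤ D)
    (hpair : ∀ a b, 2 ≤ N a →
      Δ a + (1 - η) * phi (N b) (σ b) ≤ Δ b + (1 + η) * phi ((N a : ℝ) - 1) (σ a))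
    (hT : 2 * (K : ℝ) ≤ (T : ℝ) - 1) (hsmall : D + 2 / √(((T : ℝ) - 1) / K - 1) ≤ η / 4)
    {q : ℝ} (hq : q = (1 + η) ^ 2 / (1 - η)) (a : Fin K) :
    count σ Δ (N 0) a / q ^ 2 ≤ N a ∧ N a ≤ q ^ 2 * count σ Δ (N 0) a := by
  have hK : (0 : ℝ) < K := by exact_mod_cast Nat.pos_of_neZero K
  have hNpos : ∀ a, (0 : ℝ) < N a := fun a => by exact_mod_cast hN a
  have hT1 : 1 ≤ T := by
    have : (1 : ℝ) ≤ T := by linarith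
    exact_mod_cast this
  have hsumR : ∑ a, (N a : ℝ) = T - 1 := by
    rw [← Nat.cast_sum, hsum, Nat.cast_sub hT1, Nat.cast_one]
  obtain ⟨b, hb⟩ : ∃ b, ((T : ℝ) - 1) / K ≤ N b := by
    by_contra! hcon
    have := Finset.sum_lt_sum_of_nonempty (s := Finset.univ) ⟨(0 : Fin K), Finset.mem_univ _⟩
      fun a _ => hcon a
    rw [hsumR, Finset.sum_const, Finset.card_univ, Fintype.card_fin, nsmul_eq_mul,
      mul_div_cancel₀ _ hK.ne'] at this
    exact lt_irrefl _ this
  have hTK : 2 ≤ ((T : ℝ) - 1) / K := by rwa [le_div_iff₀ hK]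
  have hb2 : 2 ≤ N b := by
    have : (2 : ℝ) ≤ N b := hTK.trans hb
    exact_mod_cast this
  -- The most pulled arm `b` has a tiny bonus at its last pull, and the comparison with `b` makes
  -- the bonus of every arm tiny. So every count is large, and `N a ≤ (1 + η)(N a - 1)` removes the
  -- off-by-one at the price of one factor `1 + η`.
  have hlarge : ∀ a, 1 + η ≤ η * N a := by
    intro a
    have h1 := hpair b a hb2
    have h2 : phi ((N b : ℝ) - 1) (σ b) ≤ 1 / √(((T : ℝ) - 1) / K - 1) :=
      (phi_le_inv_sqrt (by linarith) (hσ1 b)).trans (one_div_le_one_div_of_le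
        (Real.sqrt_pos.2 (by linarith)) (Real.sqrt_le_sqrt (by linarith)))
    have h3 : (1 + η) * phi ((N b : ℝ) - 1) (σ b) ≤ 2 * (1 / √(((T : ℝ) - 1) / K - 1)) := by
      gcongr
      · exact (phi_pos (by linarith) _).le
      · linarith
    have h4 : (1 - η) * (1 / N a) ≤ (1 - η) * phi (N a) (σ a) :=
      mul_le_mul_of_nonneg_left (inv_le_phi (hNpos a) _) (by linarith)
    have h5 : (1 - η) * (1 / N a) ≤ η / 4 := by
      rw [mul_one_div] at h3
      linarith [hΔ b, hΔD a]
    rw [mul_one_div, div_le_iff₀ (hNpos a)] at h5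
    linarith
  have hN2 : ∀ a, 2 ≤ N a := by
    intro a
    by_contra! hcon
    have : N a = 1 := by have := hN a; omega
    have h := hlarge a
    rw [this] at h
    norm_num at h
  have hphi : ∀ a, phi ((N a : ℝ) - 1) (σ a) ≤ (1 + η) * phi (N a) (σ a) := by
    intro a
    have h2 : (2 : ℝ) ≤ N a := by exact_mod_cast hN2 a
    have h1 := phi_div_le (n := (N a : ℝ) - 1) (by linarith) (by linarith : 1 ≤ 1 + η) (hσ a)
    rw [div_le_iff₀ (by linarith)] at h1
    have h3 := phi_antitone (m := (1 + η) * ((N a : ℝ) - 1)) (hNpos a)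
      (by linarith [hlarge a]) (hσ a)
    nlinarith
  have hpair' : ∀ a b, Δ a + (1 - η) * phi (N b) (σ b) ≤
      Δ b + (1 + η) ^ 2 * phi (N a) (σ a) := by
    intro a b
    have := mul_le_mul_of_nonneg_left (hphi a) (by linarith : 0 ≤ 1 + η)
    linarith [hpair a b (hN2 a)]
  have hη : 0 < 1 - η := by linarith
  have hq1 : 1 ≤ q := by rw [hq, le_div_iff₀ hη]; nlinarith
  have hqη : (1 + η) ^ 2 = q * (1 - η) := by rw [hq, div_mul_cancel₀ _ hη.ne']
  have hx : 0 < phi (N 0) (σ 0) + Δ a := by linarith [phi_pos (hNpos 0) (σ 0), hΔ a]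
  have hy := phi_pos (hNpos a) (σ a)
  have hlow : phi (N 0) (σ 0) + Δ a ≤ q * phi (N a) (σ a) := by
    have h1 := hpair' a 0
    rw [hΔ0, hqη] at h1
    have h2 : (1 - η) * (phi (N 0) (σ 0) + Δ a) ≤ (1 - η) * (q * phi (N a) (σ a)) := by
      nlinarith [hΔ a]
    exact le_of_mul_le_mul_left h2 hη
  have hupp : phi (N a) (σ a) ≤ q * (phi (N 0) (σ 0) + Δ a) := by
    have h1 := hpair' 0 a
    rw [hΔ0, hqη] at h1
    have h3 : Δ a ≤ (1 + η) ^ 2 * Δ a := le_mul_of_one_le_left (hΔ a) (by nlinarith)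
    rw [hqη] at h3
    have h2 : (1 - η) * phi (N a) (σ a) ≤ (1 - η) * (q * (phi (N 0) (σ 0) + Δ a)) := by
      linarith
    exact le_of_mul_le_mul_left h2 hη
  have hq0 : 0 < q := by linarith
  have hNa : phiInv (phi (N a) (σ a)) (σ a) = N a := phiInv_phi (hNpos a) (hσ a)
  constructor
  · calc count σ Δ (N 0) a / q ^ 2 ≤ phiInv (q * (phi (N 0) (σ 0) + Δ a)) (σ a) :=
          phiInv_div_sq_le hx hq1
      _ ≤ phiInv (phi (N a) (σ a)) (σ a) := phiInv_antitone hy hupp (hσ a)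
      _ = N a := hNa
  · have h1 := phiInv_div_sq_le (σ := σ a) hy hq1
    rw [hNa, div_le_iff₀ (by positivity)] at h1
    have h2 := phiInv_antitone hx hlow (hσ a)
    calc (N a : ℝ) ≤ phiInv (q * phi (N a) (σ a)) (σ a) * q ^ 2 := h1
      _ ≤ phiInv (phi (N 0) (σ 0) + Δ a) (σ a) * q ^ 2 := by gcongr
      _ = _ := mul_comm _ _

end Comparison

/-! ### The stability assumption in real terms -/

lemma le_mul_of_ofReal_div_le {s d r : ℝ} (hd : 0 ≤ d) (hr : 0 ≤ r)
    (h : ENNReal.ofReal s / ENNReal.ofReal d ≤ ENNReal.ofReal r) : s ≤ r * d := by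
  rcases hd.eq_or_lt with rfl | hd
  · rw [mul_zero]
    by_contra! hs
    rw [ENNReal.ofReal_zero, ENNReal.div_zero (ENNReal.ofReal_pos.2 hs).ne', top_le_iff] at h
    exact ENNReal.ofReal_ne_top h
  · rw [← ENNReal.ofReal_div_of_pos hd, ENNReal.ofReal_le_ofReal_iff hr, div_le_iff₀ hd] at h
    exact h

lemma mul_le_of_le_ofReal_div {s d r : ℝ} (hs : 0 ≤ s) (hd : 0 ≤ d)
    (h : ENNReal.ofReal r ≤ ENNReal.ofReal s / ENNReal.ofReal d) : r * d ≤ s := by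
  rcases hd.eq_or_lt with rfl | hd
  · rwa [mul_zero]
  · rwa [← ENNReal.ofReal_div_of_pos hd, ENNReal.ofReal_le_ofReal_iff (by positivity),
      le_div_iff₀ hd] at h

/-- An inverse bounded by `C` means that the truncated difference is at least `1/C > 0`, so
truncation is inactive and the real inequality follows; a minimum bounded by `C` yields the
disjunction. -/
lemma cases_of_stabilityBound_le {K : ℕ} [NeZero K] {ρ : ℝ} {T : ℕ} {P : Fin K → Measure ℝ}
    {C : ℝ} (hC : 1 ≤ C) {a : Fin K} (ha : a ≠ 0)
    (h : stabilityBound ρ T P a ≤ ENNReal.ofReal C) :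
    (∀ b, b ≠ 0 → sigmaBar ρ T P b ^ 2 ≤
      (1 / ((K : ℝ) - 1) - 1 / C) * (T * gapBar ρ T P b ^ 2)) ∨
    (1 + 1 / C) * (T * gapBar ρ T P a ^ 2) ≤ sigmaBar ρ T P a ^ 2 ∨
    sigmaBar ρ T P a ≤ C * max (sigmaBar ρ T P 0) (1 / √(T : ℝ)) := by
  have hC0 : 0 < C := by linarith
  have hK : 1 < K := by
    rcases a with ⟨i, hi⟩
    have : i ≠ 0 := fun h => ha (Fin.ext h)
    omega
  have hK' : (1 : ℝ) < K := by exact_mod_cast hK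
  have hCinv : (ENNReal.ofReal C)⁻¹ = ENNReal.ofReal (1 / C) := by
    rw [← ENNReal.ofReal_inv_of_pos hC0, one_div]
  have hCpos : 0 < ENNReal.ofReal (1 / C) := ENNReal.ofReal_pos.2 (by positivity)
  rw [stabilityBound, inf_le_iff, inf_le_iff] at h
  rcases h with (h | h) | h
  · left
    intro b hb
    have h1 : (1 / ((K : ℝ≥0∞) - 1) - ratio ρ T P b)⁻¹ ≤ ENNReal.ofReal C :=
      (le_iSup₂ (f := fun b (_ : b ≠ 0) => (1 / ((K : ℝ≥0∞) - 1) - ratio ρ T P b)⁻¹) b hb).trans h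
    have eK : 1 / ((K : ℝ≥0∞) - 1) = ENNReal.ofReal (1 / ((K : ℝ) - 1)) := by
      rw [ENNReal.ofReal_div_of_pos (by linarith), ENNReal.ofReal_sub _ zero_le_one,
        ENNReal.ofReal_natCast, ENNReal.ofReal_one]
    rw [← ENNReal.inv_le_inv, inv_inv, hCinv, eK] at h1
    have hlt : ratio ρ T P b < ENNReal.ofReal (1 / ((K : ℝ) - 1)) :=
      tsub_pos_iff_lt.1 (hCpos.trans_le h1)
    replace h1 := add_le_of_le_tsub_right_of_le hlt.le h1
    rw [add_comm] at h1
    have hle : ENNReal.ofReal (1 / C) ≤ ENNReal.ofReal (1 / ((K : ℝ) - 1)) :=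
      le_add_self.trans h1
    have hle' : 1 / C ≤ 1 / ((K : ℝ) - 1) :=
      (ENNReal.ofReal_le_ofReal_iff (by
        have : 0 < (K : ℝ) - 1 := by linarith
        positivity)).1 hle
    have h2 := ENNReal.le_sub_of_add_le_right ENNReal.ofReal_ne_top h1
    rw [← ENNReal.ofReal_sub _ (by positivity)] at h2
    exact le_mul_of_ofReal_div_le (by positivity) (sub_nonneg.2 hle') h2
  · right; left
    rw [← ENNReal.inv_le_inv, inv_inv, hCinv] at h
    have hlt : 1 < ratio ρ T P a := tsub_pos_iff_lt.1 (hCpos.trans_le h)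
    replace h := add_le_of_le_tsub_left_of_le hlt.le h
    rw [← ENNReal.ofReal_one,
      ← ENNReal.ofReal_add zero_le_one (by positivity)] at h
    exact mul_le_of_le_ofReal_div (sq_nonneg _) (by positivity) h
  · right; right
    exact le_mul_of_ofReal_div_le (le_max_of_le_right (by positivity)) hC0.le h

/-! ### From approximate to exact fixed point -/

section Asymptotic

variable {K : ℕ} [NeZero K]

lemma isFixedPoint_iff {ρ : ℝ} {T : ℕ} {P : Fin K → Measure ℝ} (hT : 0 < T) {n : ℝ} :
    IsFixedPoint ρ T P n ↔
      0 < n ∧ ∑ a, count (sigmaBar ρ T P) (gapBar ρ T P) n a = T := by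
  have hT' : (0 : ℝ) < T := by exact_mod_cast hT
  refine and_congr_right fun _ => ?_
  rw [← div_eq_one_iff_eq hT'.ne', Finset.sum_div]
  have e : ∀ a : Fin K, count (sigmaBar ρ T P) (gapBar ρ T P) n a / T =
      max (sigmaBar ρ T P a ^ 2) (phi n (sigmaBar ρ T P 0) + gapBar ρ T P a) /
        (T * (phi n (sigmaBar ρ T P 0) + gapBar ρ T P a) ^ 2) := fun a => by
    rw [count, phiInv, div_div, mul_comm]
  simp_rw [e]

lemma gapBar_zero (ρ : ℝ) (T : ℕ) (P : Fin K → Measure ℝ) : gapBar ρ T P 0 = 0 := by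
  simp [gapBar, gap]

lemma gapBar_nonneg {ρ : ℝ} {T : ℕ} {P : Fin K → Measure ℝ} (hR : 0 < ρ * Real.log T)
    (hopt : ∀ a, mean (P a) ≤ mean (P 0)) (a : Fin K) : 0 ≤ gapBar ρ T P a :=
  div_nonneg (sub_nonneg.2 (hopt a)) hR.le

lemma nStar_eq_count {ρ : ℝ} {T : ℕ} {P : Fin K → Measure ℝ} {n : ℝ} (hn : 0 < n) (a : Fin K) :
    nStar ρ T P n a = count (sigmaBar ρ T P) (gapBar ρ T P) n a := by
  unfold nStar
  split_ifs with h
  · rw [h, count_zero sigmaBar_nonneg (gapBar_zero ρ T P) hn]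
  · rfl

/-- A uniform real bound for the stability quantities of all suboptimal arms. -/
lemma exists_stabilityBound_le {ρ : ℝ} {P : ℕ → Fin K → Measure ℝ}
    (hbdd : ∀ a : Fin K, a ≠ 0 →
      limsup (fun T : ℕ => stabilityBound ρ T (P T) a) atTop < ⊤) :
    ∃ C : ℝ, 1 ≤ C ∧ ∀ᶠ T : ℕ in atTop, ∀ a : Fin K, a ≠ 0 →
      stabilityBound ρ T (P T) a ≤ ENNReal.ofReal C := by
  have h1 : ∀ a : Fin K, ∃ C : ℝ, a ≠ 0 →
      ∀ᶠ T : ℕ in atTop, stabilityBound ρ T (P T) a ≤ ENNReal.ofReal C := by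
    intro a
    by_cases ha : a = 0
    · exact ⟨0, fun h => absurd ha h⟩
    obtain ⟨c, hc1, hc2⟩ := exists_between (hbdd a ha)
    refine ⟨c.toReal, fun _ => ?_⟩
    filter_upwards [eventually_lt_of_limsup_lt hc1] with T hT
    rw [ENNReal.ofReal_toReal hc2.ne]
    exact hT.le
  choose C hC using h1
  refine ⟨1 + ∑ a, |C a|, le_add_of_nonneg_right (Finset.sum_nonneg fun _ _ => abs_nonneg _), ?_⟩
  rw [eventually_all]
  intro a
  by_cases ha : a = 0
  · exact Eventually.of_forall fun _ h => absurd ha h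
  filter_upwards [hC a ha] with T hT _
  refine hT.trans (ENNReal.ofReal_le_ofReal ?_)
  have := Finset.single_le_sum (f := fun a => |C a|) (fun _ _ => abs_nonneg _) (Finset.mem_univ a)
  linarith [le_abs_self (C a)]

/-- The pull counts are close to the deterministic ones as soon as they nearly agree with `count`
and the fixed-point equation is stable. -/
lemma abs_div_count_sub_one_lt {σ Δ : Fin K → ℝ} (hσ : ∀ a, 0 ≤ σ a) (hΔ : ∀ a, 0 ≤ Δ a)
    {N : Fin K → ℕ} (hN : ∀ a, 1 ≤ N a) {T : ℕ} (hsum : ∑ a, N a = T - 1) (hT1 : 1 ≤ T)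
    {q r ε n τ : ℝ} (hq : 1 < q) (hqr : q ≤ r) (hqτ : q ^ 3 < τ) (hr : r ^ 4 < 1 + ε)
    (hn : 0 < n) (hTq : (T : ℝ) / q ≤ T - 1)
    (hclose : ∀ a, count σ Δ (N 0) a / q ^ 2 ≤ N a ∧ N a ≤ q ^ 2 * count σ Δ (N 0) a)
    (hstable : ∀ m, 0 < m → (T : ℝ) / τ < ∑ a, count σ Δ m a →
      ∑ a, count σ Δ m a < τ * T → n / r < m ∧ m < r * n) (a : Fin K) :
    |(N a : ℝ) / count σ Δ n a - 1| < ε := by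
  have hT0 : (0 : ℝ) < T := by exact_mod_cast hT1
  have hq0 : 0 < q := by linarith
  have hr1 : 1 < r := by linarith
  have hr0 : 0 < r := by linarith
  have hN0 : (0 : ℝ) < N 0 := by exact_mod_cast hN 0
  have hsumR : ∑ a, (N a : ℝ) = T - 1 := by
    rw [← Nat.cast_sum, hsum, Nat.cast_sub hT1, Nat.cast_one]
  have hup : ∑ a, count σ Δ (N 0) a ≤ q ^ 2 * (T - 1) := by
    rw [← hsumR, Finset.mul_sum]
    refine Finset.sum_le_sum fun a _ => ?_
    have := (hclose a).1
    rw [div_le_iff₀ (by positivity)] at this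
    linarith
  have hlow : (T : ℝ) - 1 ≤ q ^ 2 * ∑ a, count σ Δ (N 0) a := by
    rw [← hsumR, Finset.mul_sum]
    exact Finset.sum_le_sum fun a _ => (hclose a).2
  have hq2 : q ^ 2 ≤ q ^ 3 := pow_le_pow_right₀ hq.le (by norm_num)
  have hτ0 : 0 < τ := lt_trans (by positivity) hqτ
  -- In `q³`, two factors come from `hclose` and one from replacing `T - 1`, the number of rounds
  -- counted, by `T`.
  obtain ⟨h1, h2⟩ := hstable (N 0) hN0
    (by
      rw [div_le_iff₀ hq0] at hTq
      rw [div_lt_iff₀ hτ0]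
      set S := ∑ a, count σ Δ (N 0) a
      have hS : 0 < S := Finset.sum_pos (fun a _ => count_pos hΔ hN0 a) ⟨0, Finset.mem_univ _⟩
      calc (T : ℝ) ≤ (T - 1) * q := hTq
        _ ≤ q ^ 2 * S * q := by gcongr
        _ = S * q ^ 3 := by ring
        _ < S * τ := by gcongr)
    (by
      calc _ ≤ q ^ 2 * ((T : ℝ) - 1) := hup
        _ ≤ q ^ 2 * T := by gcongr; linarith
        _ < τ * T := by gcongr; linarith)
  have hc := count_pos (σ := σ) hΔ hn a
  have hqr2 : q ^ 2 ≤ r ^ 2 := by gcongr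
  -- One `r²` bounds the `q²` of `hclose`; the other is the growth of `count` when `n` moves by a
  -- factor `r`.
  have hupper : (N a : ℝ) ≤ r ^ 4 * count σ Δ n a := by
    calc (N a : ℝ) ≤ q ^ 2 * count σ Δ (N 0) a := (hclose a).2
      _ ≤ r ^ 2 * count σ Δ (r * n) a := by
        gcongr
        · exact (count_pos hΔ hN0 a).le
        · exact count_mono hσ hΔ hN0 h2.le a
      _ ≤ r ^ 2 * (r ^ 2 * count σ Δ n a) := by
        gcongr; exact count_mul_le hσ hΔ hn hr1.le a
      _ = _ := by ring
  have hlower : count σ Δ n a ≤ r ^ 4 * N a := by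
    have h3 : n ≤ r * N 0 := by rw [div_lt_iff₀ hr0] at h1; linarith
    have h4 := (hclose a).1
    rw [div_le_iff₀ (by positivity)] at h4
    calc count σ Δ n a ≤ count σ Δ (r * N 0) a := count_mono hσ hΔ hn h3 a
      _ ≤ r ^ 2 * count σ Δ (N 0) a := count_mul_le hσ hΔ hN0 hr1.le a
      _ ≤ r ^ 2 * (N a * q ^ 2) := by gcongr
      _ ≤ r ^ 2 * (N a * r ^ 2) := by gcongr
      _ = _ := by ring
  set w := (N a : ℝ) / count σ Δ n a with hw
  have hw1 : w ≤ r ^ 4 := by rwa [hw, div_le_iff₀ hc]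
  have hw2 : 1 ≤ r ^ 4 * w := by rw [hw, ← mul_div_assoc, le_div_iff₀ hc, one_mul]; exact hlower
  have hw0 : 0 ≤ w := by positivity
  have hr4 : 1 ≤ r ^ 4 := one_le_pow₀ hr1.le
  rw [abs_lt]
  constructor
  · by_contra! hcon
    nlinarith
  · linarith

end Asymptotic

lemma exists_small_concentration_level {r τ : ℝ} (hr : 1 < r) (hτ : 1 < τ) :
    ∃ δ : ℝ, 0 < δ ∧ 15 * δ ≤ 1 / 2 ∧ (1 + 15 * δ) ^ 2 / (1 - 15 * δ) ≤ r ∧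
      ((1 + 15 * δ) ^ 2 / (1 - 15 * δ)) ^ 3 < τ := by
  have hq : Tendsto (fun δ : ℝ => (1 + 15 * δ) ^ 2 / (1 - 15 * δ)) (𝓝 0) (𝓝 1) := by
    have : ContinuousAt (fun δ : ℝ => (1 + 15 * δ) ^ 2 / (1 - 15 * δ)) 0 :=
      ContinuousAt.div (by fun_prop) (by fun_prop) (by norm_num)
    simpa [ContinuousAt] using this
  have h3 := hq.pow 3
  rw [one_pow] at h3
  have hev : ∀ᶠ δ : ℝ in 𝓝 0, δ < 1 / 30 := eventually_lt_nhds (by norm_num)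
  obtain ⟨δ, ⟨⟨h1, h2⟩, h3⟩, h4⟩ := (((hq.eventually_le_const hr).and
    (h3.eventually_lt_const hτ)).and hev |>.filter_mono nhdsWithin_le_nhds |>.and
    (self_mem_nhdsWithin : Set.Ioi (0 : ℝ) ∈ 𝓝[>] 0)).exists
  exact ⟨δ, h4, by linarith, h1, h2⟩

end UCBV

/-! ### Assembly of the estimates -/

theorem theorem5p1 {K : ℕ} [NeZero K] (ρ : ℝ) (hρ : 1 < ρ)
    (P : ℕ → Fin K → Measure ℝ) [∀ T a, IsProbabilityMeasure (P T a)]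
    (hsupp : ∀ T a, ∀ᵐ x ∂(P T a), x ∈ Set.Icc (0 : ℝ) 1)
    (hopt : ∀ T a, UCBV.mean (P T a) ≤ UCBV.mean (P T 0))
    {Ω : ℕ → Type*} [∀ T, MeasurableSpace (Ω T)]
    (μ : (T : ℕ) → Measure (Ω T)) [∀ T, IsProbabilityMeasure (μ T)]
    (A : (T : ℕ) → ℕ → Ω T → Fin K) (X : (T : ℕ) → ℕ → Ω T → ℝ)
    (hrun : ∀ T, K ≤ T → UCBV.IsRun ρ T (P T) (μ T) (A T) (X T))
    (hbdd : ∀ a : Fin K, a ≠ 0 →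
      limsup (fun T : ℕ => UCBV.stabilityBound ρ T (P T) a) atTop < ⊤) :
    (∀ T : ℕ, 2 ≤ T → ∃! n : ℝ, UCBV.IsFixedPoint ρ T (P T) n) ∧
    ∀ n₁ : ℕ → ℝ, (∀ T : ℕ, 2 ≤ T → UCBV.IsFixedPoint ρ T (P T) (n₁ T)) →
      ∀ a : Fin K, ∀ ε : ℝ, 0 < ε →
        Tendsto (fun T : ℕ => μ T {ω |
            ε ≤ |(UCBV.pulls (A T) a T ω : ℝ) / UCBV.nStar ρ T (P T) (n₁ T) a - 1|})
          atTop (𝓝 0) := by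
  open UCBV in
  have hRpos : ∀ T : ℕ, 2 ≤ T → 0 < ρ * Real.log T := fun T hT =>
    mul_pos (by linarith) (Real.log_pos (by exact_mod_cast hT))
  refine ⟨fun T hT => ?_, fun n₁ hn₁ a ε hε => ?_⟩
  · simp_rw [isFixedPoint_iff (by omega : 0 < T)]
    exact existsUnique_sum_count sigmaBar_nonneg (gapBar_nonneg (hRpos T hT) (hopt T))
      (gapBar_zero ρ T (P T)) (by positivity)
  obtain ⟨C, hC, hCbd⟩ := exists_stabilityBound_le hbdd
  have hK : (0 : ℝ) < K := by exact_mod_cast Nat.pos_of_neZero K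
  have hK1 : (1 : ℝ) ≤ K := by exact_mod_cast Nat.pos_of_neZero K
  -- The constants are fixed in the order `ε`, `r`, `τ`, `δ`: the accuracy for `n` determines the
  -- tolerance for the total, which determines the concentration level. Only then is `T` taken
  -- large.
  obtain ⟨r, hr1, hr⟩ : ∃ r : ℝ, 1 < r ∧ r ^ 4 < 1 + ε := by
    have h : Tendsto (fun r : ℝ => r ^ 4) (𝓝[>] 1) (𝓝 1) := by
      have : Tendsto (fun r : ℝ => r ^ 4) (𝓝 1) (𝓝 (1 ^ 4)) := (continuous_pow 4).tendsto 1
      rw [one_pow] at this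
      exact this.mono_left nhdsWithin_le_nhds
    obtain ⟨r, h1, h2⟩ := ((h.eventually_lt_const (by linarith : 1 < 1 + ε)).and
      (self_mem_nhdsWithin : Set.Ioi (1 : ℝ) ∈ 𝓝[>] 1)).exists
    exact ⟨r, h2, h1⟩
  have hCK : 1 ≤ 4 * C * K := by nlinarith
  obtain ⟨τ, hτ, hstable⟩ := sum_count_stable (K := K) (c := 1 / (4 * C * K)) (r := r)
    (by positivity) (by rw [div_le_one (by positivity)]; exact hCK) hr1
  obtain ⟨δ, hδ0, hδ, hqr, hqτ⟩ := exists_small_concentration_level hr1 hτ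
  set q := (1 + 15 * δ) ^ 2 / (1 - 15 * δ) with hqdef
  have hq : 1 < q := by rw [hqdef, lt_div_iff₀ (by linarith)]; nlinarith
  have hRlim : Tendsto (fun T : ℕ => ρ * Real.log T) atTop atTop :=
    (Real.tendsto_log_atTop.comp tendsto_natCast_atTop_atTop).const_mul_atTop (by linarith)
  have hTlim : Tendsto (fun T : ℕ => (T : ℝ) - 1) atTop atTop :=
    tendsto_atTop_add_const_right _ _ tendsto_natCast_atTop_atTop
  have hsmall : Tendsto (fun T : ℕ => 1 / (ρ * Real.log T) + 2 / √(((T : ℝ) - 1) / K - 1)) atTop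
      (𝓝 0) := by
    have h1 : Tendsto (fun T : ℕ => √(((T : ℝ) - 1) / K - 1)) atTop atTop :=
      Real.tendsto_sqrt_atTop.comp
        (tendsto_atTop_add_const_right _ _ (hTlim.atTop_div_const hK))
    simpa using (hRlim.const_div_atTop 1).add (h1.const_div_atTop 2)
  have hbound := tendsto_concentration_bound K (s := δ ^ 2 * ρ) (by positivity)
  refine tendsto_of_tendsto_of_tendsto_of_le_of_le' tendsto_const_nhds hbound
    (Eventually.of_forall fun _ => zero_le) ?_
  filter_upwards [hCbd, eventually_ge_atTop (K + 1), eventually_ge_atTop 2,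
    hRlim.eventually_ge_atTop 1, hRlim.eventually_ge_atTop (1 / δ ^ 2),
    hTlim.eventually_ge_atTop (2 * K), hsmall.eventually_le_const (by positivity : 0 < 15 * δ / 4),
    (tendsto_natCast_atTop_atTop (R := ℝ)).eventually_ge_atTop (q / (q - 1))]
    with T hCT hTK hT2 hR1 hRδ hTK2 hsm hTq
  have hR := hRpos T hT2
  have hrunT := hrun T (by omega)
  have hT0 : (0 : ℝ) < T := by positivity
  have hL : 1 ≤ δ ^ 2 * (ρ * Real.log T) := by
    rw [div_le_iff₀ (by positivity)] at hRδ; linarith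
  have hσ : ∀ a, 0 ≤ sigmaBar ρ T (P T) a := sigmaBar_nonneg
  have hΔ : ∀ a, 0 ≤ gapBar ρ T (P T) a := gapBar_nonneg hR (hopt T)
  have hΔ0 := gapBar_zero ρ T (P T)
  have hσ1 : ∀ a, sigmaBar ρ T (P T) a ≤ 1 := fun a =>
    div_le_one_of_le₀ (Real.sqrt_le_sqrt ((variance_le_one (hsupp T a)).trans hR1))
      (Real.sqrt_nonneg _)
  have hΔ1 : ∀ a, gapBar ρ T (P T) a ≤ 1 / (ρ * Real.log T) := fun a => by
    have h0 := (mean_mem_Icc (hsupp T 0)).2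
    have h1 := (mean_mem_Icc (hsupp T a)).1
    unfold gapBar gap
    gcongr
    linarith
  obtain ⟨hn, hnsum⟩ := (isFixedPoint_iff (by omega)).1 (hn₁ T hT2)
  have hmeas := hrunT.measure_not_concentrated_le (hsupp T) hδ0 (by linarith) hL
  rw [← mul_assoc (δ ^ 2)] at hmeas
  refine le_trans (measure_mono_ae ?_) hmeas
  filter_upwards [hrunT.initial, hrunT.greedy] with ω hinit hgreedy hω hconc
  have hω : ε ≤ |(pulls (A T) a T ω : ℝ) / nStar ρ T (P T) (n₁ T) a - 1| := hω
  rw [nStar_eq_count hn] at hω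
  refine hω.not_gt ?_
  have hN : ∀ a, 1 ≤ pulls (A T) a T ω := fun a => one_le_pulls hinit a hTK
  have hsum := sum_pulls (A T) T ω
  refine abs_div_count_sub_one_lt (N := fun a => pulls (A T) a T ω) hσ hΔ hN hsum (by omega)
    hq hqr hqτ hr hn ?_ ?_ ?_ a
  · rw [div_le_iff₀ (by linarith)] at hTq ⊢
    linarith
  · exact pulls_near_count hσ hσ1 hΔ hΔ0 hN hsum (by positivity) hδ hΔ1
      (fun a b ha => gapBar_add_phi_le (by linarith) hR hTK hinit hgreedy hconc a b ha)
      hTK2 hsm hqdef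
  · exact hstable _ _ hσ hΔ T (n₁ T) hT0 hn hnsum
      (exists_wellConditioned_arm hσ hΔ hΔ0 hC hT0 hn hnsum fun a ha =>
        cases_of_stabilityBound_le hC ha (hCT a ha))
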